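/- Let $\mathcal H$ be a (possibly infinite-dimensional) separable complex Hilbert space, $\mathcal T(\mathcal H)$ the space of trace class operators on $\mathcal H$ with the trace norm $\|T\|_1=\operatorname{Tr}\sqrt{T^\dagger T}$, and $\mathcal D(\mathcal H)$ the set of density operators (positive semi-definite trace class operators of unit trace). The weak*-topology on $\mathcal T(\mathcal H)$ is the coarsest topology for which $T\mapsto\operatorname{Tr}(TK)$ is continuous for every compact operator $K$ on $\mathcal H$. For positive semi-definite $X,Y\in\mathcal T(\mathcal H)$ with spectral decompositions $X=\sum_i x_i|e_i\rangle\langle e_i|$, $Y=\sum_j y_j|f_j\rangle\langle f_j|$ over orthonormal bases of $\mathcal H$ (zero eigenvalues included), let $$D(X\|Y)=\sum_{i,j}|\langle e_i|f_j\rangle|^2\,\bigl(x_i\ln x_i-x_i\ln y_j+y_j-x_i\bigr)\in[0,+\infty],$$ with $0\ln 0=0$, $-x\ln 0=+\infty$ for $x>0$, and $0\cdot\infty=0$. Let $(M_n)_{n\in\mathbb N}$ be a sequence of compact operators on $\mathcal H$ with $\|M_n\psi-\psi\|\to0$ as $n\to\infty$ for all $\psi\in\mathcal H$. Let $\mathcal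 F\subseteq\mathcal D(\mathcal H)$ be a non-empty set of density operators and put $\operatorname{cone}(\mathcal F)=\{\lambda\sigma:\lambda\in[0,\infty),\ \sigma\in\mathcal F\}$. Assume that (i) $\mathcal F$ is convex; (ii) $\mathcal F$ is closed in the trace norm; (iii) $M_nXM_n^\dagger\in\operatorname{cone}(\mathcal F)$ for all $n\in\mathbb N$ and all $X\in\operatorname{cone}(\mathcal F)$. Then $\operatorname{cone}(\mathcal F)$ is weak*-closed. Moreover, the function $D_{\mathcal F}(\rho)=\inf_{\sigma\in\mathcal F}D(\rho\|\sigma)$ is (a) always achieved: for every $\rho\in\mathcal D(\mathcal H)$ there exists $\sigma\in\mathcal F$ such that $D_{\mathcal F}(\rho)=D(\rho\|\sigma)$; and (b) lower semi-continuous with respect to the trace norm topology: if $\rho$ and $\rho_n$ ($n\in\mathbb N$) are density operators on $\mathcal H$ with $\|\rho_n-\rho\|_1\to0$, then $D_{\mathcal F}(\rho)\le\liminf_{n\to\infty}D_{\mathcal F}(\rho_n)$. -/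

import Mathlib

open Filter Topology
open scoped ENNReal

noncomputable section

namespace QResource

universe u

variable {H : Type u} [NormedAddCommGroup H] [InnerProductSpace ℂ H] [CompleteSpace H]

/-! ### Trace class operators -/

variable (H) in
/-- The index set of a fixed Hilbert basis (complete orthonormal system) of `H`. -/
def basisIndex : Set H := (exists_hilbertBasis ℂ H).choose

variable (H) in
/-- A fixed Hilbert basis of `H`. The trace norm of every operator and the trace of every trace class
operator do not depend on this choice. -/
def refBasis : HilbertBasis (basisIndex H) ℂ H := (exists_hilbertBasis ℂ H).choose_spec.choose

/-- The trace norm `‖T‖₁ = Tr √(T† T)` of a bounded operator, as an element of `[0, ∞]`.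
Here `CFC.abs T = √(T† T)`. -/
def traceNorm (T : H →L[ℂ] H) : ℝ≥0∞ :=
  ∑' i, ENNReal.ofReal (inner ℂ (refBasis H i) (CFC.abs T (refBasis H i))).re

/-- `T` is of trace class if its trace norm is finite. -/
def IsTraceClass (T : H →L[ℂ] H) : Prop := traceNorm T < ⊤

/-- The trace `Tr T = ∑ i, ⟨b i, T b i⟩` (the series is absolutely convergent if `T` is of trace
class; the value is only meant for such `T`). -/
def trace (T : H →L[ℂ] H) : ℂ :=
  ∑' i, inner ℂ (refBasis H i) (T (refBasis H i))

variable (H) in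
/-- The trace class operators on `H`. -/
def TraceClass : Type u := {T : H →L[ℂ] H // IsTraceClass T}

variable (H) in
/-- Density operators: positive semi-definite trace class operators of unit trace. -/
def densityOperators : Set (H →L[ℂ] H) :=
  {T | T.IsPositive ∧ IsTraceClass T ∧ trace T = 1}

/-- The cone generated by a set of operators, `{c X : c ∈ [0, ∞), X ∈ S}`. -/
def cone (S : Set (H →L[ℂ] H)) : Set (H →L[ℂ] H) :=
  {Y | ∃ c : ℝ, 0 ≤ c ∧ ∃ X ∈ S, Y = c • X}

/-! ### The two topologies -/

/-- A set of trace class operators is closed for the trace norm: it contains every trace class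
operator that can be approximated in trace norm by its elements. -/
def IsTraceNormClosed (S : Set (H →L[ℂ] H)) : Prop :=
  ∀ T : H →L[ℂ] H, IsTraceClass T →
    (∀ ε : ℝ≥0∞, 0 < ε → ∃ X ∈ S, traceNorm (X - T) < ε) → T ∈ S

variable (H) in
/-- The weak* topology on the trace class operators: the coarsest topology that makes
`T ↦ Tr (T K)` continuous for every compact operator `K`. -/
@[reducible] def weakStarTopology : TopologicalSpace (TraceClass H) :=
  ⨅ K : {K : H →L[ℂ] H // IsCompactOperator K},
    TopologicalSpace.induced (fun T : TraceClass H => trace (T.1 * K.1)) inferInstance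

/-- A set of trace class operators is weak*-closed. -/
def IsWeakStarClosed (S : Set (H →L[ℂ] H)) : Prop :=
  IsClosed[weakStarTopology H] {T : TraceClass H | T.1 ∈ S}

/-! ### Relative entropy -/

/-- A spectral decomposition `T = ∑ i, t i |e i⟩⟨e i|`, completed with an orthonormal basis of the
kernel: a Hilbert basis of eigenvectors of `T`, with their real eigenvalues. It exists for every
self-adjoint compact `T`, in particular for every positive trace class operator. -/
structure SpectralDecomposition (T : H →L[ℂ] H) where
  /-- the index type -/
  ι : Type u
  /-- the orthonormal eigenvectors -/
  vec : HilbertBasis ι ℂ H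
  /-- the eigenvalues -/
  val : ι → ℝ
  /-- the eigenvalue equation -/
  apply_vec : ∀ i, T (vec i) = (val i : ℂ) • vec i

/-- The number `x ln x - x ln y + y - x ∈ [0, ∞]` for `x, y ≥ 0`, with the conventions
`0 ln 0 = 0 ln y = 0`, and `- x ln 0 = ∞` for `x > 0`. It is nonnegative, so that
`ENNReal.ofReal` does not truncate it. -/
def entropyTerm (x y : ℝ) : ℝ≥0∞ :=
  if y = 0 ∧ x ≠ 0 then ⊤
  else ENNReal.ofReal (x * Real.log x - x * Real.log y + y - x)

/-- Umegaki's relative entropy of positive trace class operators,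
`D(X ‖ Y) = ∑ i j, |⟨e i, f j⟩|² (x i ln x i - x i ln y j + y j - x i) ∈ [0, ∞]`, where
`X = ∑ i, x i |e i⟩⟨e i|` and `Y = ∑ j, y j |f j⟩⟨f j|`. The sum has the same value for all
spectral decompositions of `X` and `Y` (it only involves the eigenvalues and the orthogonal
projections onto the eigenspaces), so the infimum merely selects this common value. -/
def relEntropy (X Y : H →L[ℂ] H) : ℝ≥0∞ :=
  ⨅ (e : SpectralDecomposition X) (f : SpectralDecomposition Y),
    ∑' (i : e.ι) (j : f.ι),
      ENNReal.ofReal (‖inner ℂ (e.vec i) (f.vec j)‖ ^ 2) * entropyTerm (e.val i) (f.val j)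

/-- The relative entropy of resource `D_F(ρ) = inf_{σ ∈ F} D(ρ ‖ σ)`. -/
def relEntropyOfResource (F : Set (H →L[ℂ] H)) (ρ : H →L[ℂ] H) : ℝ≥0∞ :=
  ⨅ σ ∈ F, relEntropy ρ σ

end QResource

end

noncomputable section

set_option linter.unusedSectionVars false

namespace QResource

universe u

section

variable {H : Type u} [NormedAddCommGroup H] [InnerProductSpace ℂ H] [CompleteSpace H]

/-! ### Hilbert–Schmidt operators -/

/-! Two mechanisms carry the theorem.

Closedness. Positive trace class operators whose matrix entries and traces converge also converge in
trace norm (`tendsto_traceNorm_sub`). Weak* limits alone may lose trace, but conjugation by a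
compact `M` repairs this: `Tr (M X M†) = Tr (X M† M)` with `M† M` compact, so it is weak*-continuous
in `X`. If elements `A` of the cone tend weak* to `X`, then for each `n` the conjugates `M n A (M
n)†` tend to `M n X (M n)†` in trace norm, and after normalisation closedness of `F` puts this limit
in the cone. Letting `n → ∞`, `M n X (M n)†` tends to `X` in trace norm, so `X` is in the cone
(`mem_cone_of_tendsto_conj`).

Entropy. The scalar term is the integral over `s > 0` of `(y - x)² / (y + s x)` against `ds / (1 +
s)²` (`lintegral_entropyKernel`). For fixed `s`, completing the square shows that the overlap sum of
the kernels is the supremum, over finite rank `Z`, of a functional involving finitely many matrix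
entries of the two operators, hence weakly continuous. Fatou's lemma then gives joint weak lower
semicontinuity (`relEntropy_le_liminf`).

Both assertions on `D_F` follow by the direct method (`exists_mem_relEntropy_le`): states in `F`
have a weakly convergent subsequence, and its limit lies in the cone, so it is `t • σ` with `σ ∈ F`
and `t ≤ 1`. Since `D(ρ‖tσ) = D(ρ‖σ) - ln t - (1 - t)` for `t > 0` and `-ln t ≥ 1 - t`, replacing
`tσ` by `σ` costs nothing. -/

lemma enorm_sq_eq_ofReal {E : Type*} [SeminormedAddCommGroup E] (x : E) :
    ‖x‖ₑ ^ 2 = ENNReal.ofReal (‖x‖ ^ 2) := by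
  rw [← ofReal_norm, ENNReal.ofReal_pow (norm_nonneg x)]

lemma hasSum_norm_inner_sq {ι : Type*} (b : HilbertBasis ι ℂ H) (x : H) :
    HasSum (fun i => ‖inner ℂ (b i) x‖ ^ 2) (‖x‖ ^ 2) := by
  have h := b.hasSum_inner_mul_inner x x
  have h2 := (Complex.hasSum_re h)
  have e : (inner ℂ x x : ℂ).re = ‖x‖ ^ 2 := inner_self_eq_norm_sq (𝕜 := ℂ) x
  rw [e] at h2
  convert h2 using 2 with i
  have := inner_mul_symm_re_eq_norm (𝕜 := ℂ) x (b i)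
  rw [RCLike.re_eq_complex_re] at this
  rw [this, norm_mul, norm_inner_symm x, sq]

lemma tsum_enorm_inner_sq {ι : Type*} (b : HilbertBasis ι ℂ H) (x : H) :
    ∑' i, ‖inner ℂ (b i) x‖ₑ ^ 2 = ‖x‖ₑ ^ 2 := by
  simp only [enorm_sq_eq_ofReal]
  rw [← (hasSum_norm_inner_sq b x).tsum_eq,
    ENNReal.ofReal_tsum_of_nonneg (fun _ => by positivity) (hasSum_norm_inner_sq b x).summable]

lemma enorm_inner_symm (x y : H) : ‖(inner ℂ x y : ℂ)‖ₑ = ‖(inner ℂ y x : ℂ)‖ₑ := by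
  rw [← ofReal_norm, norm_inner_symm, ofReal_norm]

lemma enorm_inner_le (x y : H) : ‖(inner ℂ x y : ℂ)‖ₑ ≤ ‖x‖ₑ * ‖y‖ₑ := by
  simp only [← ofReal_norm]
  rw [← ENNReal.ofReal_mul (norm_nonneg _)]
  exact ENNReal.ofReal_le_ofReal (norm_inner_le_norm x y)

/-- The square of the Hilbert–Schmidt norm. -/
def hsSq (C : H →L[ℂ] H) : ℝ≥0∞ := ∑' i, ‖C (refBasis H i)‖ₑ ^ 2

/-- By Parseval and Tonelli both sides are the sum of all squared matrix entries. One side does not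
involve `g` and the other does not involve `b`, which gives basis independence. -/
lemma tsum_enorm_sq_adjoint {ι κ : Type*} (b : HilbertBasis ι ℂ H) (g : HilbertBasis κ ℂ H)
    (C : H →L[ℂ] H) :
    ∑' i, ‖C (b i)‖ₑ ^ 2 = ∑' j, ‖ContinuousLinearMap.adjoint C (g j)‖ₑ ^ 2 := by
  calc ∑' i, ‖C (b i)‖ₑ ^ 2 = ∑' i, ∑' j, ‖inner ℂ (g j) (C (b i))‖ₑ ^ 2 := by
        simp only [tsum_enorm_inner_sq]
    _ = ∑' j, ∑' i, ‖inner ℂ (b i) (ContinuousLinearMap.adjoint C (g j))‖ₑ ^ 2 := by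
        rw [ENNReal.tsum_comm]
        simp only [ContinuousLinearMap.adjoint_inner_right, enorm_inner_symm (C _)]
    _ = _ := by simp only [tsum_enorm_inner_sq]

lemma hsSq_eq_adjoint {κ : Type*} (g : HilbertBasis κ ℂ H) (C : H →L[ℂ] H) :
    hsSq C = ∑' j, ‖ContinuousLinearMap.adjoint C (g j)‖ₑ ^ 2 :=
  tsum_enorm_sq_adjoint _ g C

lemma hsSq_adjoint (C : H →L[ℂ] H) : hsSq (ContinuousLinearMap.adjoint C) = hsSq C :=
  (hsSq_eq_adjoint _ C).symm

lemma hsSq_eq {κ : Type*} (g : HilbertBasis κ ℂ H) (C : H →L[ℂ] H) :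
    hsSq C = ∑' j, ‖C (g j)‖ₑ ^ 2 := by
  rw [← hsSq_adjoint, hsSq_eq_adjoint g, ContinuousLinearMap.adjoint_adjoint]

lemma enorm_apply_sq_le (A : H →L[ℂ] H) (x : H) : ‖A x‖ₑ ^ 2 ≤ ‖A‖ₑ ^ 2 * ‖x‖ₑ ^ 2 := by
  rw [← mul_pow]
  exact pow_le_pow_left₀ (zero_le) (A.le_opENorm x) 2

lemma hsSq_mul_le_left (A C : H →L[ℂ] H) : hsSq (A * C) ≤ ‖A‖ₑ ^ 2 * hsSq C := by
  unfold hsSq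
  rw [← ENNReal.tsum_mul_left]
  exact ENNReal.tsum_le_tsum fun i => enorm_apply_sq_le A _

lemma enorm_adjoint (A : H →L[ℂ] H) : ‖ContinuousLinearMap.adjoint A‖ₑ = ‖A‖ₑ := by
  simp only [← ofReal_norm, LinearIsometryEquiv.norm_map]

lemma adjoint_mul (A B : H →L[ℂ] H) : ContinuousLinearMap.adjoint (A * B) =
    ContinuousLinearMap.adjoint B * ContinuousLinearMap.adjoint A :=
  ContinuousLinearMap.adjoint_comp A B

lemma hsSq_mul_le_right (A C : H →L[ℂ] H) : hsSq (C * A) ≤ ‖A‖ₑ ^ 2 * hsSq C := by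
  rw [← hsSq_adjoint, adjoint_mul, ← enorm_adjoint A, ← hsSq_adjoint C]
  exact hsSq_mul_le_left _ _

lemma enorm_sq_le_hsSq (A : H →L[ℂ] H) (x : H) : ‖A x‖ₑ ^ 2 ≤ hsSq A * ‖x‖ₑ ^ 2 := by
  rw [← hsSq_adjoint, ← tsum_enorm_inner_sq (refBasis H), hsSq, ← ENNReal.tsum_mul_right]
  refine ENNReal.tsum_le_tsum fun i => ?_
  rw [← ContinuousLinearMap.adjoint_inner_left, ← mul_pow]
  exact pow_le_pow_left₀ (zero_le) (enorm_inner_le _ _) 2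

lemma exists_sqrt {A : H →L[ℂ] H} (hA : A.IsPositive) :
    ∃ S : H →L[ℂ] H, ContinuousLinearMap.adjoint S = S ∧ S * S = A := by
  have h0 : 0 ≤ A := (ContinuousLinearMap.nonneg_iff_isPositive A).2 hA
  refine ⟨CFC.sqrt A, ?_, CFC.sqrt_mul_sqrt_self A h0⟩
  exact ((ContinuousLinearMap.nonneg_iff_isPositive _).1 (CFC.sqrt_nonneg A)).isSelfAdjoint

lemma traceNorm_of_isPositive {A : H →L[ℂ] H} (hA : A.IsPositive) :
    traceNorm A = ∑' i, ENNReal.ofReal (inner ℂ (refBasis H i) (A (refBasis H i))).re := by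
  rw [traceNorm, CFC.abs_of_nonneg A ((ContinuousLinearMap.nonneg_iff_isPositive A).2 hA)]

lemma inner_adjoint_mul_self (C : H →L[ℂ] H) (x : H) :
    inner ℂ x ((ContinuousLinearMap.adjoint C * C) x) = ((‖C x‖ ^ 2 : ℝ) : ℂ) := by
  rw [mul_apply_eq_comp, ContinuousLinearMap.adjoint_inner_right,
    inner_self_eq_norm_sq_to_K]
  simp

lemma ofReal_re_inner_adjoint_mul_self (C : H →L[ℂ] H) (x : H) :
    ENNReal.ofReal (inner ℂ x ((ContinuousLinearMap.adjoint C * C) x)).re = ‖C x‖ₑ ^ 2 := by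
  rw [inner_adjoint_mul_self, Complex.ofReal_re, enorm_sq_eq_ofReal]

lemma isPositive_adjoint_mul_self (C : H →L[ℂ] H) :
    (ContinuousLinearMap.adjoint C * C).IsPositive :=
  ContinuousLinearMap.isPositive_adjoint_comp_self C

lemma traceNorm_adjoint_mul_self (C : H →L[ℂ] H) :
    traceNorm (ContinuousLinearMap.adjoint C * C) = hsSq C := by
  rw [traceNorm_of_isPositive (isPositive_adjoint_mul_self C), hsSq]
  simp only [ofReal_re_inner_adjoint_mul_self]

lemma traceNorm_eq_tsum {κ : Type*} (g : HilbertBasis κ ℂ H) {A : H →L[ℂ] H}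
    (hA : A.IsPositive) :
    traceNorm A = ∑' j, ENNReal.ofReal (inner ℂ (g j) (A (g j))).re := by
  obtain ⟨S, hS, rfl⟩ := exists_sqrt hA
  have := traceNorm_adjoint_mul_self S
  rw [hsSq_eq g] at this
  simp only [← ofReal_re_inner_adjoint_mul_self] at this
  rwa [hS] at this

/-! ### Finite coordinate projections -/

/-- The orthogonal projection onto the span of finitely many vectors of the reference basis. -/
def coordProj (F : Finset (basisIndex H)) : H →L[ℂ] H :=
  ∑ i ∈ F, InnerProductSpace.rankOne ℂ (refBasis H i) (refBasis H i)

lemma coordProj_apply (F : Finset (basisIndex H)) (x : H) :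
    coordProj F x = ∑ i ∈ F, inner ℂ (refBasis H i) x • refBasis H i := by
  simp [coordProj, sum_apply]

lemma inner_refBasis [DecidableEq (basisIndex H)] (i j : basisIndex H) :
    inner ℂ (refBasis H i) (refBasis H j) = if i = j then (1 : ℂ) else 0 :=
  orthonormal_iff_ite.1 (refBasis H).orthonormal i j

lemma coordProj_basis (F : Finset (basisIndex H)) (j : basisIndex H) [Decidable (j ∈ F)] :
    coordProj F (refBasis H j) = if j ∈ F then refBasis H j else 0 := by
  classical
  rw [coordProj_apply]
  simp only [inner_refBasis, ite_smul, one_smul, zero_smul, Finset.sum_ite_eq']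
  congr

lemma adjoint_coordProj (F : Finset (basisIndex H)) :
    ContinuousLinearMap.adjoint (coordProj F) = coordProj F := by
  simp only [coordProj, map_sum, InnerProductSpace.adjoint_rankOne]

lemma tendsto_coordProj (x : H) :
    Tendsto (fun F : Finset (basisIndex H) => coordProj F x) atTop (𝓝 x) := by
  have := (refBasis H).hasSum_repr x
  simp only [HilbertBasis.repr_apply_apply] at this
  simpa only [coordProj_apply, HasSum, SummationFilter.unconditional_filter] using this

lemma isCompactOperator_rankOne (x y : H) :
    IsCompactOperator (InnerProductSpace.rankOne ℂ x y : H →L[ℂ] H) := by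
  rw [InnerProductSpace.rankOne_def']
  have h : IsCompactOperator (ContinuousLinearMap.toSpanSingleton ℂ x) :=
    isCompactOperator_of_locallyCompactSpace_rng _
  exact h.comp_clm _

lemma isCompactOperator_coordProj (F : Finset (basisIndex H)) :
    IsCompactOperator (coordProj F) := by
  have : coordProj F ∈ compactOperator (RingHom.id ℂ) H H := by
    refine Submodule.sum_mem _ fun i _ => ?_
    exact isCompactOperator_rankOne _ _
  exact this

lemma norm_one_sub_coordProj_apply_le (F : Finset (basisIndex H)) (x : H) :
    ‖(1 - coordProj F : H →L[ℂ] H) x‖ ≤ ‖x‖ := by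
  classical
  rw [← abs_of_nonneg (norm_nonneg _), ← abs_of_nonneg (norm_nonneg x), ← sq_le_sq,
    ← (hasSum_norm_inner_sq (refBasis H) x).tsum_eq,
    ← (hasSum_norm_inner_sq (refBasis H) ((1 - coordProj F : H →L[ℂ] H) x)).tsum_eq]
  refine Summable.tsum_le_tsum (fun i => ?_) (hasSum_norm_inner_sq _ _).summable
    (hasSum_norm_inner_sq _ _).summable
  have : inner ℂ (refBasis H i) ((1 - coordProj F : H →L[ℂ] H) x)
      = if i ∈ F then 0 else inner ℂ (refBasis H i) x := by
    rw [← ContinuousLinearMap.adjoint_inner_left, map_sub, adjoint_coordProj,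
      sub_apply, coordProj_basis]
    split_ifs <;> simp [ContinuousLinearMap.adjoint_one]
  rw [this]
  split_ifs
  · simp
  · rfl

lemma hsSq_mul_one_sub_coordProj (C : H →L[ℂ] H) (F : Finset (basisIndex H)) :
    hsSq (C * (1 - coordProj F)) = ∑' i : {i // i ∉ F}, ‖C (refBasis H i)‖ₑ ^ 2 := by
  classical
  refine Eq.trans ?_ (tsum_subtype {i | i ∉ F} fun i => ‖C (refBasis H i)‖ₑ ^ 2).symm
  rw [hsSq]
  refine tsum_congr fun i => ?_
  rw [mul_apply_eq_comp, sub_apply, coordProj_basis]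
  by_cases h : i ∈ F <;> simp [h]

lemma tendsto_hsSq_mul_one_sub_coordProj {C : H →L[ℂ] H} (hC : hsSq C ≠ ⊤) :
    Tendsto (fun F => hsSq (C * (1 - coordProj F))) atTop (𝓝 0) := by
  simp only [hsSq_mul_one_sub_coordProj]
  exact ENNReal.tendsto_tsum_compl_atTop_zero hC

lemma sum_add_hsSq_mul_one_sub_coordProj (C : H →L[ℂ] H) (F : Finset (basisIndex H)) :
    ∑ i ∈ F, ‖C (refBasis H i)‖ₑ ^ 2 + hsSq (C * (1 - coordProj F)) = hsSq C := by
  rw [hsSq_mul_one_sub_coordProj]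
  exact ENNReal.sum_add_tsum_compl (F : Finset _) _

lemma opNorm_le_sqrt_hsSq {A : H →L[ℂ] H} (h : hsSq A ≠ ⊤) : ‖A‖ ≤ √(hsSq A).toReal := by
  refine A.opNorm_le_bound (Real.sqrt_nonneg _) fun x => ?_
  refine le_of_sq_le_sq ?_ (by positivity)
  rw [mul_pow, Real.sq_sqrt ENNReal.toReal_nonneg]
  have := ENNReal.toReal_mono (ENNReal.mul_ne_top h (by simp)) (enorm_sq_le_hsSq A x)
  simpa using this

/-- The truncations `C * coordProj F` have finite rank and converge in operator norm, because the
Hilbert–Schmidt norm dominates it and the tails vanish. -/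
lemma isCompactOperator_of_hsSq {C : H →L[ℂ] H} (hC : hsSq C ≠ ⊤) : IsCompactOperator C := by
  refine isCompactOperator_of_tendsto (l := atTop)
    (F := fun F : Finset (basisIndex H) => C * coordProj F) ?_
    (Eventually.of_forall fun F => (isCompactOperator_coordProj F).clm_comp C)
  rw [tendsto_iff_norm_sub_tendsto_zero]
  have h1 := (ENNReal.tendsto_toReal ENNReal.zero_ne_top).comp
    (tendsto_hsSq_mul_one_sub_coordProj hC)
  have h2 := (Real.continuous_sqrt.tendsto _).comp h1
  rw [ENNReal.toReal_zero, Real.sqrt_zero] at h2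
  refine squeeze_zero (fun _ => norm_nonneg _) (fun F => ?_) h2
  rw [norm_sub_rev]
  have e : C - C * coordProj F = C * (1 - coordProj F) := by rw [mul_sub, mul_one]
  rw [e]
  refine opNorm_le_sqrt_hsSq (ne_top_of_le_ne_top hC ?_)
  rw [← sum_add_hsSq_mul_one_sub_coordProj C F]
  exact le_add_self

/-! ### Spectral decompositions of compact self-adjoint operators -/

theorem exists_spectralDecomposition {T : H →L[ℂ] H} (hc : IsCompactOperator T)
    (hT : ContinuousLinearMap.adjoint T = T) : Nonempty (SpectralDecomposition T) := by
  have hsym : T.IsSymmetric := ContinuousLinearMap.isSelfAdjoint_iff_isSymmetric.1 hT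
  let V : ℂ → Submodule ℂ H := fun μ => Module.End.eigenspace (T : Module.End ℂ H) μ
  have hVc : ∀ μ, IsClosed (V μ : Set H) := fun μ => by
    have : (V μ : Set H) = {x | T x = μ • x} := by
      ext x; simp [V]
    rw [this]
    exact isClosed_eq T.continuous (continuous_const_smul μ)
  have : ∀ μ, CompleteSpace (V μ) := fun μ => (hVc μ).completeSpace_coe
  choose w b hb using fun μ => exists_hilbertBasis ℂ (V μ)
  -- Bases of the individual eigenspaces are glued together. Indexing by real `r` loses nothing,
  -- since a symmetric operator has only real eigenvalues.
  let v : (Σ r : ℝ, w (r : ℂ)) → H := fun p => (b (p.1 : ℂ) p.2 : H)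
  have hfam := hsym.orthogonalFamily_eigenspaces
  have hv : Orthonormal ℂ v := by
    have h1 := hfam.orthonormal_sigma_orthonormal (v_family := fun μ => b μ)
      fun μ => (b μ).orthonormal
    exact h1.comp (fun p : Σ r : ℝ, w (r : ℂ) => (⟨(p.1 : ℂ), p.2⟩ : Σ μ : ℂ, w μ)) (by
      rintro ⟨r, i⟩ ⟨s, j⟩ h
      obtain ⟨h1, h2⟩ := Sigma.mk.inj_iff.1 h
      have h3 : r = s := Complex.ofReal_injective h1
      subst h3
      exact congrArg (Sigma.mk r) (eq_of_heq h2))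
  have hperp : (Submodule.span ℂ (Set.range v))ᗮ = ⊥ := by
    rw [eq_bot_iff,
      ← ContinuousLinearMap.orthogonalComplement_iSup_eigenspaces_eq_bot hc hsym]
    rw [← Submodule.orthogonal_closure]
    refine Submodule.orthogonal_le (iSup_le fun μ => ?_)
    intro x hx
    by_cases hx0 : x = 0
    · subst hx0; exact Submodule.zero_mem _
    have hμ : (starRingEnd ℂ) μ = μ :=
      hsym.conj_eigenvalue_eq_self (Module.End.hasEigenvalue_of_hasEigenvector ⟨hx, hx0⟩)
    obtain ⟨r, rfl⟩ := Complex.conj_eq_iff_real.1 hμ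
    have h1 := ((b (r : ℂ)).hasSum_repr ⟨x, hx⟩).mapL (V (r : ℂ)).subtypeL
    refine mem_closure_of_tendsto h1 (Eventually.of_forall fun s => ?_)
    refine Submodule.sum_mem _ fun i _ => ?_
    rw [map_smul]
    exact Submodule.smul_mem _ _ (Submodule.subset_span ⟨⟨r, i⟩, rfl⟩)
  refine ⟨⟨_, HilbertBasis.mkOfOrthogonalEqBot hv hperp, fun p => p.1, fun p => ?_⟩⟩
  rw [HilbertBasis.coe_mkOfOrthogonalEqBot]
  exact Module.End.mem_eigenspace_iff.1 (b (p.1 : ℂ) p.2).2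

lemma SpectralDecomposition.inner_apply {T : H →L[ℂ] H} (g : SpectralDecomposition T) (i : g.ι) :
    inner ℂ (g.vec i) (T (g.vec i)) = (g.val i : ℂ) := by
  rw [g.apply_vec, inner_smul_right, inner_self_eq_norm_sq_to_K, g.vec.orthonormal.1 i]
  simp

/-- Here `|T|² x = t² x`. If `t ≠ 0`, the vector `h = |T| x - |t| x` satisfies `|T| h = -|t| h`,
which positivity of `|T|` allows only for `h = 0`; if `t = 0`, then `‖|T| x‖² = 0`. -/
lemma abs_apply_of_apply_eq_smul {T : H →L[ℂ] H} (hT : ContinuousLinearMap.adjoint T = T)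
    {x : H} {t : ℝ} (hx : T x = (t : ℂ) • x) : CFC.abs T x = ((|t| : ℝ) : ℂ) • x := by
  have hpos : (CFC.abs T).IsPositive :=
    (ContinuousLinearMap.nonneg_iff_isPositive _).1 (CFC.abs_nonneg T)
  have hsq : CFC.abs T (CFC.abs T x) = ((t ^ 2 : ℝ) : ℂ) • x := by
    have := congrArg (fun A : H →L[ℂ] H => A x) (CFC.abs_mul_abs T)
    simp only [mul_apply_eq_comp, ContinuousLinearMap.star_eq_adjoint, hT, hx, map_smul] at this
    rw [this, smul_smul]
    push_cast
    rw [sq]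
  by_cases ht : t = 0
  · subst ht
    have h0 : inner ℂ (CFC.abs T x) (CFC.abs T x) = (0 : ℂ) := by
      rw [hpos.inner_left_eq_inner_right, hsq]
      simp
    rw [inner_self_eq_zero] at h0
    simp [h0]
  · set h := CFC.abs T x - ((|t| : ℝ) : ℂ) • x with hh
    have h1 : CFC.abs T h = -(((|t| : ℝ) : ℂ) • h) := by
      rw [hh, map_sub, map_smul, hsq, smul_sub, smul_smul, ← Complex.ofReal_mul,
        abs_mul_abs_self, sq]
      abel
    have h2 := hpos.re_inner_nonneg_right h
    rw [h1, inner_neg_right, inner_smul_right, inner_self_eq_norm_sq_to_K] at h2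
    have h3 : |t| * ‖h‖ ^ 2 ≤ 0 := by
      have : RCLike.re (-(((|t| : ℝ) : ℂ) * (‖h‖ : ℂ) ^ 2)) = -(|t| * ‖h‖ ^ 2) := by
        rw [← Complex.ofReal_pow, ← Complex.ofReal_mul, ← Complex.ofReal_neg]
        exact Complex.ofReal_re _
      have h2' : 0 ≤ -(|t| * ‖h‖ ^ 2) := this ▸ h2
      linarith
    have h4 : ‖h‖ = 0 := by
      have := abs_pos.2 ht
      by_contra hne
      have : 0 < |t| * ‖h‖ ^ 2 := by positivity
      linarith
    exact sub_eq_zero.1 (norm_eq_zero.1 h4)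

/-- In an eigenbasis the trace norm is a sum of absolute diagonal entries, so it can be estimated by
splitting inner products, without a triangle inequality for `traceNorm`. -/
lemma traceNorm_eq_tsum_spectral {T : H →L[ℂ] H} (hT : ContinuousLinearMap.adjoint T = T)
    (g : SpectralDecomposition T) :
    traceNorm T = ∑' i, ‖inner ℂ (g.vec i) (T (g.vec i))‖ₑ := by
  have hpos : (CFC.abs T).IsPositive :=
    (ContinuousLinearMap.nonneg_iff_isPositive _).1 (CFC.abs_nonneg T)
  have h1 : traceNorm T = traceNorm (CFC.abs T) := by
    rw [traceNorm, traceNorm_of_isPositive hpos]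
  rw [h1, traceNorm_eq_tsum g.vec hpos]
  refine tsum_congr fun i => ?_
  rw [g.inner_apply, abs_apply_of_apply_eq_smul hT (g.apply_vec i), inner_smul_right,
    inner_self_eq_norm_sq_to_K, g.vec.orthonormal.1 i, ← ofReal_norm]
  simp

end

section

variable {H : Type u} [NormedAddCommGroup H] [InnerProductSpace ℂ H] [CompleteSpace H]

/-! ### Trace norm estimates -/

lemma tsum_mul_le_rpow_mul_rpow {ι : Type*} (f g : ι → ℝ≥0∞) :
    ∑' i, f i * g i ≤ (∑' i, f i ^ 2) ^ (1 / 2 : ℝ) * (∑' i, g i ^ 2) ^ (1 / 2 : ℝ) := by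
  refine ENNReal.summable.tsum_le_of_sum_le fun s => ?_
  have h := ENNReal.inner_le_Lp_mul_Lq s f g (p := 2) (q := 2)
    (Real.HolderConjugate.two_two)
  refine h.trans ?_
  simp only [ENNReal.rpow_two]
  gcongr <;> exact ENNReal.sum_le_tsum s

lemma tsum_enorm_inner_le {κ : Type*} (g : HilbertBasis κ ℂ H) (C D : H →L[ℂ] H) :
    ∑' i, ‖(inner ℂ (C (g i)) (D (g i)) : ℂ)‖ₑ ≤
      hsSq C ^ (1 / 2 : ℝ) * hsSq D ^ (1 / 2 : ℝ) := by
  rw [hsSq_eq g C, hsSq_eq g D]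
  refine le_trans ?_ (tsum_mul_le_rpow_mul_rpow _ _)
  exact ENNReal.tsum_le_tsum fun i => enorm_inner_le _ _

/-- Expanding in the reference basis, the entry `(k, m)` gets the weight `∑ i, |⟨g i, e k⟩| |⟨g i, e
m⟩|`, at most `1` by Cauchy–Schwarz. -/
lemma tsum_enorm_inner_coordProj_le {κ : Type*} (g : HilbertBasis κ ℂ H) (T : H →L[ℂ] H)
    (F : Finset (basisIndex H)) :
    ∑' i, ‖(inner ℂ (coordProj F (g i)) (T (coordProj F (g i))) : ℂ)‖ₑ ≤
      ∑ k ∈ F, ∑ m ∈ F, ‖(inner ℂ (refBasis H k) (T (refBasis H m)) : ℂ)‖ₑ := by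
  have h1 : ∀ x : H, ‖(inner ℂ (coordProj F x) (T (coordProj F x)) : ℂ)‖ₑ ≤
      ∑ k ∈ F, ∑ m ∈ F, ‖(inner ℂ (refBasis H k) (T (refBasis H m)) : ℂ)‖ₑ *
        (‖inner ℂ x (refBasis H k)‖ₑ * ‖inner ℂ x (refBasis H m)‖ₑ) := by
    intro x
    rw [coordProj_apply, map_sum, sum_inner]
    refine (enorm_sum_le _ _).trans (Finset.sum_le_sum fun k _ => ?_)
    rw [inner_sum]
    refine (enorm_sum_le _ _).trans (Finset.sum_le_sum fun m _ => ?_)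
    rw [map_smul, inner_smul_left, inner_smul_right, enorm_mul, enorm_mul, inner_conj_symm,
      enorm_inner_symm (refBasis H m) x]
    exact le_of_eq (by ring)
  have h2 : ∀ k m : basisIndex H,
      ∑' i, ‖inner ℂ (g i) (refBasis H k)‖ₑ * ‖inner ℂ (g i) (refBasis H m)‖ₑ ≤ 1 := by
    intro k m
    refine (tsum_mul_le_rpow_mul_rpow _ _).trans ?_
    have : ∀ k, ‖refBasis H k‖ₑ = 1 := fun k => by
      rw [← ofReal_norm, (refBasis H).orthonormal.1 k, ENNReal.ofReal_one]
    simp only [tsum_enorm_inner_sq, this, one_pow, ENNReal.one_rpow, mul_one, le_refl]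
  calc _ ≤ ∑' i, ∑ k ∈ F, ∑ m ∈ F, ‖(inner ℂ (refBasis H k) (T (refBasis H m)) : ℂ)‖ₑ *
        (‖inner ℂ (g i) (refBasis H k)‖ₑ * ‖inner ℂ (g i) (refBasis H m)‖ₑ) :=
        ENNReal.tsum_le_tsum fun i => h1 _
    _ = ∑ k ∈ F, ∑ m ∈ F, ‖(inner ℂ (refBasis H k) (T (refBasis H m)) : ℂ)‖ₑ *
        ∑' i, ‖inner ℂ (g i) (refBasis H k)‖ₑ * ‖inner ℂ (g i) (refBasis H m)‖ₑ := by
        rw [Summable.tsum_finsetSum fun _ _ => ENNReal.summable]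
        refine Finset.sum_congr rfl fun k _ => ?_
        rw [Summable.tsum_finsetSum fun _ _ => ENNReal.summable]
        simp only [ENNReal.tsum_mul_left]
    _ ≤ _ := by
        refine Finset.sum_le_sum fun k _ => Finset.sum_le_sum fun m _ => ?_
        exact (mul_le_mul_right (h2 k m) _).trans (mul_one _).le

lemma isCompactOperator_mul_self {S : H →L[ℂ] H} (hS : hsSq S ≠ ⊤) :
    IsCompactOperator (S * S) :=
  (isCompactOperator_of_hsSq hS).clm_comp S

lemma hsSq_mul_coordProj_le (C : H →L[ℂ] H) (F : Finset (basisIndex H)) :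
    hsSq (C * coordProj F) ≤ hsSq C := by
  classical
  refine ENNReal.tsum_le_tsum fun i => ?_
  rw [mul_apply_eq_comp, coordProj_basis]
  split_ifs <;> simp

/-- The trace norm of the difference of two positive trace class operators is controlled by finitely
many matrix entries of the difference and by the tails of the two traces. -/
lemma traceNorm_sub_le {S R : H →L[ℂ] H} (hS : ContinuousLinearMap.adjoint S = S)
    (hR : ContinuousLinearMap.adjoint R = R) (hS' : hsSq S ≠ ⊤) (hR' : hsSq R ≠ ⊤)
    (F : Finset (basisIndex H)) :
    traceNorm (S * S - R * R) ≤
      ∑ k ∈ F, ∑ m ∈ F,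
        ‖(inner ℂ (refBasis H k) ((S * S - R * R) (refBasis H m)) : ℂ)‖ₑ +
      (2 * (hsSq (S * (1 - coordProj F)) ^ (1 / 2 : ℝ) * hsSq S ^ (1 / 2 : ℝ)) +
      2 * (hsSq (R * (1 - coordProj F)) ^ (1 / 2 : ℝ) * hsSq R ^ (1 / 2 : ℝ))) := by
  have hTs : ContinuousLinearMap.adjoint (S * S - R * R) = S * S - R * R := by
    rw [map_sub, adjoint_mul, adjoint_mul, hS, hR]
  have hTc : IsCompactOperator (S * S - R * R : H →L[ℂ] H) :=
    (isCompactOperator_mul_self hS').sub (isCompactOperator_mul_self hR')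
  obtain ⟨g⟩ := exists_spectralDecomposition hTc hTs
  rw [traceNorm_eq_tsum_spectral hTs g]
  set P := coordProj F with hP
  set Q : H →L[ℂ] H := 1 - P with hQ
  -- With `P + Q = 1`, every term except the compressed one contains `C * Q`, whose Hilbert–Schmidt
  -- norm is a tail.
  have key : ∀ (C : H →L[ℂ] H), ContinuousLinearMap.adjoint C = C → ∀ x : H,
      inner ℂ x ((C * C) x) = inner ℂ (P x) ((C * C) (P x)) + inner ℂ ((C * Q) x) (C x)
        + inner ℂ ((C * P) x) ((C * Q) x) := by
    intro C hC x
    have hsym : ∀ y z : H, inner ℂ (C y) z = inner ℂ y (C z) := fun y z => by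
      rw [← ContinuousLinearMap.adjoint_inner_left, hC]
    simp only [mul_apply_eq_comp, hsym, hQ, sub_apply, one_apply_eq_self, map_sub,
      inner_sub_left, inner_sub_right]
    ring
  have hle : ∀ i, ‖(inner ℂ (g.vec i) ((S * S - R * R) (g.vec i)) : ℂ)‖ₑ ≤
      ‖(inner ℂ (P (g.vec i)) ((S * S - R * R) (P (g.vec i))) : ℂ)‖ₑ +
      ((‖(inner ℂ ((S * Q) (g.vec i)) (S (g.vec i)) : ℂ)‖ₑ
        + ‖(inner ℂ ((S * P) (g.vec i)) ((S * Q) (g.vec i)) : ℂ)‖ₑ)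
      + (‖(inner ℂ ((R * Q) (g.vec i)) (R (g.vec i)) : ℂ)‖ₑ
        + ‖(inner ℂ ((R * P) (g.vec i)) ((R * Q) (g.vec i)) : ℂ)‖ₑ)) := by
    intro i
    have e : (inner ℂ (g.vec i) ((S * S - R * R) (g.vec i)) : ℂ) =
        inner ℂ (P (g.vec i)) ((S * S - R * R) (P (g.vec i)))
        + ((inner ℂ ((S * Q) (g.vec i)) (S (g.vec i))
        + inner ℂ ((S * P) (g.vec i)) ((S * Q) (g.vec i)))
        - (inner ℂ ((R * Q) (g.vec i)) (R (g.vec i))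
        + inner ℂ ((R * P) (g.vec i)) ((R * Q) (g.vec i)))) := by
      rw [sub_apply, inner_sub_right, key S hS, key R hR, sub_apply, inner_sub_right]
      ring
    rw [e]
    refine (enorm_add_le _ _).trans (add_le_add le_rfl ?_)
    refine enorm_sub_le.trans (add_le_add ?_ ?_) <;> exact enorm_add_le _ _
  refine (ENNReal.tsum_le_tsum hle).trans ?_
  rw [ENNReal.tsum_add, ENNReal.tsum_add, ENNReal.tsum_add, ENNReal.tsum_add, two_mul, two_mul]
  have hPQ : ∀ C : H →L[ℂ] H,
      ∑' i, ‖(inner ℂ ((C * P) (g.vec i)) ((C * Q) (g.vec i)) : ℂ)‖ₑ ≤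
        hsSq (C * Q) ^ (1 / 2 : ℝ) * hsSq C ^ (1 / 2 : ℝ) := fun C =>
    (tsum_enorm_inner_le g.vec _ _).trans (by rw [mul_comm]; gcongr; exact hsSq_mul_coordProj_le C F)
  refine add_le_add (tsum_enorm_inner_coordProj_le g.vec _ F) (add_le_add ?_ ?_)
  · exact add_le_add (tsum_enorm_inner_le g.vec _ _) (hPQ S)
  · exact add_le_add (tsum_enorm_inner_le g.vec _ _) (hPQ R)

/-- Positive trace class operators converge in trace norm as soon as their matrix entries and their
traces converge. -/
theorem tendsto_traceNorm_sub {α : Type*} {l : Filter α} {A : α → H →L[ℂ] H} {B : H →L[ℂ] H}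
    (hA : ∀ a, (A a).IsPositive) (hA' : ∀ a, traceNorm (A a) ≠ ⊤) (hB : B.IsPositive)
    (hB' : traceNorm B ≠ ⊤)
    (hw : ∀ i j, Tendsto (fun a => (inner ℂ (refBasis H i) (A a (refBasis H j)) : ℂ)) l
      (𝓝 (inner ℂ (refBasis H i) (B (refBasis H j)))))
    (ht : Tendsto (fun a => traceNorm (A a)) l (𝓝 (traceNorm B))) :
    Tendsto (fun a => traceNorm (A a - B)) l (𝓝 0) := by
  choose S hS hSA using fun a => exists_sqrt (hA a)
  obtain ⟨R, hR, hRB⟩ := exists_sqrt hB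
  have tS : ∀ a, hsSq (S a) = traceNorm (A a) := fun a => by
    rw [← traceNorm_adjoint_mul_self, hS, hSA]
  have tR : hsSq R = traceNorm B := by
    rw [← traceNorm_adjoint_mul_self, hR, hRB]
  have eS : ∀ a i, ‖S a (refBasis H i)‖ₑ ^ 2
      = ENNReal.ofReal (inner ℂ (refBasis H i) (A a (refBasis H i))).re := fun a i => by
    rw [← ofReal_re_inner_adjoint_mul_self, hS, hSA]
  have eR : ∀ i, ‖R (refBasis H i)‖ₑ ^ 2
      = ENNReal.ofReal (inner ℂ (refBasis H i) (B (refBasis H i))).re := fun i => by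
    rw [← ofReal_re_inner_adjoint_mul_self, hR, hRB]
  have tail : ∀ (C : H →L[ℂ] H), hsSq C ≠ ⊤ → ∀ F, hsSq (C * (1 - coordProj F))
      = hsSq C - ∑ i ∈ F, ‖C (refBasis H i)‖ₑ ^ 2 := fun C hC F => by
    rw [← sum_add_hsSq_mul_one_sub_coordProj C F]
    refine (ENNReal.add_sub_cancel_left (ne_top_of_le_ne_top hC ?_)).symm
    exact ENNReal.sum_le_tsum F
  -- A tail is the full trace minus finitely many diagonal entries; this is where convergence of the
  -- traces enters.
  have tail_lim : ∀ F, Tendsto (fun a => hsSq (S a * (1 - coordProj F))) l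
      (𝓝 (hsSq (R * (1 - coordProj F)))) := by
    intro F
    simp only [tail _ (tR.symm ▸ hB'), tail _ ((tS _).symm ▸ hA' _), tS, tR, eS, eR]
    refine ENNReal.Tendsto.sub ht (tendsto_finsetSum _ fun i _ => ?_) (Or.inl hB')
    exact ENNReal.tendsto_ofReal ((Complex.continuous_re.tendsto _).comp (hw i i))
  have tail_zero := tendsto_hsSq_mul_one_sub_coordProj (C := R) (tR.symm ▸ hB')
  let Ψ : Finset (basisIndex H) → ℝ≥0∞ := fun F =>
    2 * (hsSq (R * (1 - coordProj F)) ^ (1 / 2 : ℝ) * hsSq R ^ (1 / 2 : ℝ)) +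
      2 * (hsSq (R * (1 - coordProj F)) ^ (1 / 2 : ℝ) * hsSq R ^ (1 / 2 : ℝ))
  have half_top : hsSq R ^ (1 / 2 : ℝ) ≠ ⊤ :=
    ENNReal.rpow_ne_top_of_nonneg (by norm_num) (tR.symm ▸ hB')
  have hΨ : Tendsto Ψ atTop (𝓝 0) := by
    have h1 : Tendsto (fun F => hsSq (R * (1 - coordProj F)) ^ (1 / 2 : ℝ)) atTop (𝓝 0) := by
      have := (ENNReal.continuous_rpow_const (y := 1 / 2)).tendsto 0 |>.comp tail_zero
      simpa [Function.comp_def] using this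
    have h2 : Tendsto (fun F => 2 * (hsSq (R * (1 - coordProj F)) ^ (1 / 2 : ℝ)
        * hsSq R ^ (1 / 2 : ℝ))) atTop (𝓝 0) := by
      have := ENNReal.Tendsto.const_mul (a := 2)
        (ENNReal.Tendsto.mul_const (b := hsSq R ^ (1 / 2 : ℝ)) h1 (Or.inr half_top))
        (Or.inr (by simp))
      simpa using this
    have h3 := h2.add h2
    rwa [add_zero] at h3
  rw [ENNReal.tendsto_nhds_zero]
  intro ε hε
  obtain ⟨F, hF⟩ := ((tendsto_order.1 hΨ).2 ε hε).exists
  have hlim : Tendsto (fun a =>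
      ∑ k ∈ F, ∑ m ∈ F,
        ‖(inner ℂ (refBasis H k) ((S a * S a - R * R) (refBasis H m)) : ℂ)‖ₑ +
      (2 * (hsSq (S a * (1 - coordProj F)) ^ (1 / 2 : ℝ) * hsSq (S a) ^ (1 / 2 : ℝ)) +
      2 * (hsSq (R * (1 - coordProj F)) ^ (1 / 2 : ℝ) * hsSq R ^ (1 / 2 : ℝ)))) l
      (𝓝 (0 + Ψ F)) := by
    refine Tendsto.add ?_ (Tendsto.add ?_ tendsto_const_nhds)
    · rw [show (0 : ℝ≥0∞) = ∑ k ∈ F, ∑ m ∈ F, 0 by simp]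
      refine tendsto_finsetSum _ fun k _ => tendsto_finsetSum _ fun m _ => ?_
      have h1 := (hw k m).sub_const (inner ℂ (refBasis H k) (B (refBasis H m)))
      rw [sub_self] at h1
      have h2 := (continuous_enorm.tendsto (0 : ℂ)).comp h1
      simpa only [Function.comp_def, enorm_zero, hSA, hRB, sub_apply, inner_sub_right] using h2
    · have hr : ∀ {f : α → ℝ≥0∞} {c : ℝ≥0∞}, Tendsto f l (𝓝 c) →
          Tendsto (fun a => f a ^ (1 / 2 : ℝ)) l (𝓝 (c ^ (1 / 2 : ℝ))) := fun h =>
        (ENNReal.continuous_rpow_const.tendsto _).comp h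
      have hS2 : Tendsto (fun a => hsSq (S a)) l (𝓝 (hsSq R)) := by simpa only [tS, tR] using ht
      refine ENNReal.Tendsto.const_mul ?_ (Or.inr (by simp))
      refine ENNReal.Tendsto.mul (hr (tail_lim F)) (Or.inr half_top) (hr hS2) (Or.inr ?_)
      refine ENNReal.rpow_ne_top_of_nonneg (by norm_num) ?_
      refine ne_top_of_le_ne_top (tR.symm ▸ hB') ?_
      rw [← sum_add_hsSq_mul_one_sub_coordProj R F]
      exact le_add_self
  rw [zero_add] at hlim
  filter_upwards [(tendsto_order.1 hlim).2 ε hF] with a ha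
  rw [← hSA a, ← hRB]
  exact (traceNorm_sub_le (hS a) hR ((tS a).symm ▸ hA' a) (tR.symm ▸ hB') F).trans ha.le

/-! ### Traces of positive operators -/

lemma inner_eq_ofReal_re {A : H →L[ℂ] H} (hA : A.IsPositive) (x : H) :
    (inner ℂ x (A x) : ℂ) = (((inner ℂ x (A x) : ℂ).re : ℝ) : ℂ) := by
  obtain ⟨S, hS, rfl⟩ := exists_sqrt hA
  nth_rw 1 3 [← hS]
  rw [inner_adjoint_mul_self, Complex.ofReal_re]

lemma re_inner_nonneg {A : H →L[ℂ] H} (hA : A.IsPositive) (x : H) :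
    0 ≤ (inner ℂ x (A x) : ℂ).re :=
  hA.re_inner_nonneg_right x

lemma trace_eq_toReal_traceNorm {A : H →L[ℂ] H} (hA : A.IsPositive) :
    trace A = ((traceNorm A).toReal : ℂ) := by
  rw [trace, traceNorm_of_isPositive hA, ENNReal.tsum_toReal_eq fun _ => ENNReal.ofReal_ne_top,
    Complex.ofReal_tsum]
  refine tsum_congr fun i => ?_
  rw [ENNReal.toReal_ofReal (re_inner_nonneg hA _), ← inner_eq_ofReal_re hA]

lemma inner_real_smul (c : ℝ) (A : H →L[ℂ] H) (x y : H) :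
    (inner ℂ x ((c • A) y) : ℂ) = (c : ℂ) * inner ℂ x (A y) := by
  rw [smul_apply, ← Complex.coe_smul, inner_smul_right]

lemma isPositive_real_smul {A : H →L[ℂ] H} (hA : A.IsPositive) {c : ℝ} (hc : 0 ≤ c) :
    (c • A).IsPositive := by
  have := hA.smul_of_nonneg (c := (c : ℂ)) (by exact_mod_cast hc)
  rwa [Complex.coe_smul] at this

lemma traceNorm_smul {A : H →L[ℂ] H} (hA : A.IsPositive) {c : ℝ} (hc : 0 ≤ c) :
    traceNorm (c • A) = ENNReal.ofReal c * traceNorm A := by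
  rw [traceNorm_of_isPositive hA, traceNorm_of_isPositive (isPositive_real_smul hA hc),
    ← ENNReal.tsum_mul_left]
  refine tsum_congr fun i => ?_
  rw [inner_real_smul, Complex.re_ofReal_mul, ENNReal.ofReal_mul hc]

lemma traceNorm_of_mem_density {σ : H →L[ℂ] H} (h : σ ∈ densityOperators H) :
    traceNorm σ = 1 := by
  have h1 := trace_eq_toReal_traceNorm h.1
  rw [h.2.2] at h1
  have h2 : (traceNorm σ).toReal = 1 := by exact_mod_cast h1.symm
  rw [← ENNReal.ofReal_toReal h.2.1.ne, h2, ENNReal.ofReal_one]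

lemma eq_zero_of_traceNorm_eq_zero {A : H →L[ℂ] H} (hA : A.IsPositive) (h : traceNorm A = 0) :
    A = 0 := by
  obtain ⟨S, hS, rfl⟩ := exists_sqrt hA
  have h1 := traceNorm_adjoint_mul_self S
  rw [hS, h] at h1
  ext x
  have := enorm_sq_le_hsSq S (S x)
  rw [← h1, zero_mul] at this
  simpa using this

lemma isPositive_of_mem_cone {F : Set (H →L[ℂ] H)} (hF : F ⊆ densityOperators H) {A : H →L[ℂ] H}
    (hA : A ∈ cone F) : A.IsPositive := by
  obtain ⟨c, hc, σ, hσ, rfl⟩ := hA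
  exact isPositive_real_smul (hF hσ).1 hc

/-- The cone over a trace norm closed set of density operators is closed under convergence of matrix
entries and traces. -/
theorem mem_cone_of_tendsto {F : Set (H →L[ℂ] H)} (hF : F ⊆ densityOperators H)
    (hFne : F.Nonempty) (hFclosed : IsTraceNormClosed F) {α : Type*} {l : Filter α} [l.NeBot]
    {A : α → H →L[ℂ] H} {B : H →L[ℂ] H} (hA : ∀ a, A a ∈ cone F) (hB : B.IsPositive)
    (hB' : traceNorm B ≠ ⊤)
    (hw : ∀ i j, Tendsto (fun a => (inner ℂ (refBasis H i) (A a (refBasis H j)) : ℂ)) l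
      (𝓝 (inner ℂ (refBasis H i) (B (refBasis H j)))))
    (ht : Tendsto (fun a => traceNorm (A a)) l (𝓝 (traceNorm B))) :
    B ∈ cone F := by
  by_cases hB0 : traceNorm B = 0
  · obtain ⟨σ, hσ⟩ := hFne
    exact ⟨0, le_rfl, σ, hσ, by rw [eq_zero_of_traceNorm_eq_zero hB hB0, zero_smul]⟩
  choose c hc σ hσ hA using hA
  have htr : ∀ a, traceNorm (A a) = ENNReal.ofReal (c a) := fun a => by
    rw [hA, traceNorm_smul (hF (hσ a)).1 (hc a), traceNorm_of_mem_density (hF (hσ a)), mul_one]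
  set t := (traceNorm B).toReal with htdef
  have htpos : 0 < t := ENNReal.toReal_pos hB0 hB'
  have hct : Tendsto c l (𝓝 t) := by
    have := (ENNReal.tendsto_toReal hB').comp ht
    refine this.congr fun a => ?_
    rw [Function.comp_apply, htr, ENNReal.toReal_ofReal (hc a)]
  have hpos := isPositive_real_smul hB (inv_nonneg.2 htpos.le)
  have htr1 : traceNorm (t⁻¹ • B) = 1 := by
    rw [traceNorm_smul hB (inv_nonneg.2 htpos.le), ← ENNReal.ofReal_toReal hB', ← htdef,
      ← ENNReal.ofReal_mul (inv_nonneg.2 htpos.le), inv_mul_cancel₀ htpos.ne',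
      ENNReal.ofReal_one]
  -- The normalised operators all have trace one, so only their matrix entries remain to be checked.
  have hlim : Tendsto (fun a => traceNorm (σ a - t⁻¹ • B)) l (𝓝 0) := by
    refine tendsto_traceNorm_sub (fun a => (hF (hσ a)).1) (fun a => (hF (hσ a)).2.1.ne) hpos
      (by rw [htr1]; exact ENNReal.one_ne_top) (fun i j => ?_) ?_
    · rw [inner_real_smul]
      have hci : Tendsto (fun a => (((c a)⁻¹ : ℝ) : ℂ)) l (𝓝 ((t⁻¹ : ℝ) : ℂ)) :=
        (Complex.continuous_ofReal.tendsto _).comp (hct.inv₀ htpos.ne')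
      refine (hci.mul (hw i j)).congr' ?_
      filter_upwards [hct.eventually (lt_mem_nhds htpos)] with a ha
      rw [hA a, inner_real_smul, ← mul_assoc, ← Complex.ofReal_mul, inv_mul_cancel₀ ha.ne',
        Complex.ofReal_one, one_mul]
    · rw [htr1]
      exact tendsto_const_nhds.congr fun a => (traceNorm_of_mem_density (hF (hσ a))).symm
  refine ⟨t, htpos.le, t⁻¹ • B, hFclosed _ ?_ fun ε hε => ?_, ?_⟩
  · rw [IsTraceClass, htr1]; exact ENNReal.one_lt_top
  · obtain ⟨a, ha⟩ := ((tendsto_order.1 hlim).2 ε hε).exists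
    exact ⟨σ a, hσ a, ha⟩
  · rw [smul_smul, mul_inv_cancel₀ htpos.ne', one_smul]

end

section

variable {H : Type u} [NormedAddCommGroup H] [InnerProductSpace ℂ H] [CompleteSpace H]

/-! ### Conjugation by an approximate identity -/

lemma hsSq_eq_ofReal_tsum {C : H →L[ℂ] H} (hC : hsSq C ≠ ⊤) :
    Summable (fun i => ‖C (refBasis H i)‖ ^ 2) ∧
      hsSq C = ENNReal.ofReal (∑' i, ‖C (refBasis H i)‖ ^ 2) := by
  have h : Summable (fun i => ‖C (refBasis H i)‖ ^ 2) := by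
    have := ENNReal.summable_toReal hC
    simpa using this
  refine ⟨h, ?_⟩
  rw [hsSq, ENNReal.ofReal_tsum_of_nonneg (fun _ => by positivity) h]
  simp only [enorm_sq_eq_ofReal]

lemma hsSq_mul_ne_top_left (A : H →L[ℂ] H) {C : H →L[ℂ] H} (hC : hsSq C ≠ ⊤) :
    hsSq (A * C) ≠ ⊤ :=
  ne_top_of_le_ne_top (ENNReal.mul_ne_top (by simp) hC) (hsSq_mul_le_left A C)

/-- Banach–Steinhaus bounds the norms `‖M n‖` by some `C`, and `C ^ 2 * ‖R e i‖ ^ 2` then dominates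
the series. -/
lemma tendsto_hsSq_mul_of_strong {M : ℕ → H →L[ℂ] H} {D R : H →L[ℂ] H}
    (hM : ∀ ψ, Tendsto (fun n => M n ψ) atTop (𝓝 (D ψ))) (hR : hsSq R ≠ ⊤) :
    Tendsto (fun n => hsSq (M n * R)) atTop (𝓝 (hsSq (D * R))) := by
  obtain ⟨C, hC⟩ : ∃ C, ∀ n, ‖M n‖ ≤ C := by
    refine banach_steinhaus fun x => ?_
    obtain ⟨c, hc⟩ := (hM x).norm.bddAbove_range
    exact ⟨c, fun n => hc ⟨n, rfl⟩⟩
  simp only [fun n => (hsSq_eq_ofReal_tsum (hsSq_mul_ne_top_left (M n) hR)).2,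
    (hsSq_eq_ofReal_tsum (hsSq_mul_ne_top_left D hR)).2]
  refine ENNReal.tendsto_ofReal (tendsto_tsum_of_dominated_convergence
    (bound := fun i => C ^ 2 * ‖R (refBasis H i)‖ ^ 2)
    ((hsSq_eq_ofReal_tsum hR).1.mul_left _) (fun i => ?_) (Eventually.of_forall fun n i => ?_))
  · exact ((hM _).norm.pow 2)
  · rw [norm_pow, norm_norm, ← mul_pow, mul_apply_eq_comp]
    have := (M n).le_opNorm (R (refBasis H i))
    gcongr
    exact this.trans (mul_le_mul_of_nonneg_right (hC n) (norm_nonneg _))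

lemma conj_eq_adjoint_mul_self {R M : H →L[ℂ] H} (hR : ContinuousLinearMap.adjoint R = R) :
    M * (R * R) * ContinuousLinearMap.adjoint M =
      ContinuousLinearMap.adjoint (R * ContinuousLinearMap.adjoint M) *
        (R * ContinuousLinearMap.adjoint M) := by
  rw [adjoint_mul, hR, ContinuousLinearMap.adjoint_adjoint]
  simp only [mul_assoc]

lemma traceNorm_conj {R M : H →L[ℂ] H} (hR : ContinuousLinearMap.adjoint R = R) :
    traceNorm (M * (R * R) * ContinuousLinearMap.adjoint M) = hsSq (M * R) := by
  rw [conj_eq_adjoint_mul_self hR, traceNorm_adjoint_mul_self, ← hsSq_adjoint, adjoint_mul,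
    ContinuousLinearMap.adjoint_adjoint, hR]

lemma isPositive_conj {X : H →L[ℂ] H} (hX : X.IsPositive) (M : H →L[ℂ] H) :
    (M * X * ContinuousLinearMap.adjoint M).IsPositive := by
  obtain ⟨R, hR, rfl⟩ := exists_sqrt hX
  rw [conj_eq_adjoint_mul_self hR]
  exact isPositive_adjoint_mul_self _

lemma traceNorm_conj_ne_top {X : H →L[ℂ] H} (hX : X.IsPositive) (hX' : traceNorm X ≠ ⊤)
    (M : H →L[ℂ] H) : traceNorm (M * X * ContinuousLinearMap.adjoint M) ≠ ⊤ := by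
  obtain ⟨R, hR, rfl⟩ := exists_sqrt hX
  rw [traceNorm_conj hR]
  have h := traceNorm_adjoint_mul_self R
  rw [hR] at h
  exact hsSq_mul_ne_top_left M (h ▸ hX')

lemma inner_conj (M X : H →L[ℂ] H) (x y : H) :
    (inner ℂ x ((M * X * ContinuousLinearMap.adjoint M) y) : ℂ) =
      inner ℂ (ContinuousLinearMap.adjoint M x) (X (ContinuousLinearMap.adjoint M y)) := by
  rw [ContinuousLinearMap.adjoint_inner_left]
  rfl

/-- Two successive limits, first along `l` for fixed `n`, then in `n`. Convergence of the conjugated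
traces is left as a hypothesis because it comes from duality in the weak* case and from a trace
bound in the sequential case. -/
theorem mem_cone_of_tendsto_conj {M : ℕ → H →L[ℂ] H}
    (hM : ∀ ψ, Tendsto (fun n => M n ψ) atTop (𝓝 ψ))
    {F : Set (H →L[ℂ] H)} (hF : F ⊆ densityOperators H)
    (hFne : F.Nonempty) (hFclosed : IsTraceNormClosed F)
    (hFM : ∀ n, ∀ X ∈ cone F, M n * X * ContinuousLinearMap.adjoint (M n) ∈ cone F)
    {α : Type*} {l : Filter α} [l.NeBot] {A : α → H →L[ℂ] H} {X : H →L[ℂ] H}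
    (hA : ∀ a, A a ∈ cone F) (hX : X.IsPositive) (hX' : traceNorm X ≠ ⊤)
    (hw : ∀ x y, Tendsto (fun a => (inner ℂ x (A a y) : ℂ)) l (𝓝 (inner ℂ x (X y))))
    (ht : ∀ n, Tendsto (fun a => traceNorm (M n * A a * ContinuousLinearMap.adjoint (M n))) l
      (𝓝 (traceNorm (M n * X * ContinuousLinearMap.adjoint (M n))))) :
    X ∈ cone F := by
  have h1 : ∀ n, M n * X * ContinuousLinearMap.adjoint (M n) ∈ cone F := fun n => by
    refine mem_cone_of_tendsto hF hFne hFclosed (fun a => hFM n _ (hA a)) (isPositive_conj hX _)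
      (traceNorm_conj_ne_top hX hX' _) (fun i j => ?_) (ht n)
    simp only [inner_conj]
    exact hw _ _
  refine mem_cone_of_tendsto (l := atTop) hF hFne hFclosed h1 hX hX' (fun i j => ?_) ?_
  all_goals obtain ⟨R, hR, rfl⟩ := exists_sqrt hX
  all_goals
    have hRtop : hsSq R ≠ ⊤ := by
      have h := traceNorm_adjoint_mul_self R
      rw [hR] at h
      exact h ▸ hX'
  -- Nothing is assumed about strong convergence of `(M n)†`. Instead `M n * R → R` in
  -- Hilbert–Schmidt, hence operator, norm, and the adjoint is norm continuous.
  · have h2 : Tendsto (fun n => hsSq ((M n - 1) * R)) atTop (𝓝 0) := by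
      have := tendsto_hsSq_mul_of_strong (M := fun n => M n - 1) (D := 0) (R := R)
        (fun ψ => by simpa using (hM ψ).sub_const ψ) hRtop
      simpa [hsSq] using this
    have h3 : Tendsto (fun n => M n * R) atTop (𝓝 R) := by
      rw [tendsto_iff_norm_sub_tendsto_zero]
      have h4 := (Real.continuous_sqrt.tendsto _).comp
        ((ENNReal.tendsto_toReal ENNReal.zero_ne_top).comp h2)
      rw [ENNReal.toReal_zero, Real.sqrt_zero] at h4
      refine squeeze_zero (fun _ => norm_nonneg _) (fun n => ?_) h4
      have e : M n * R - R = (M n - 1) * R := by rw [sub_mul, one_mul]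
      rw [e]
      exact opNorm_le_sqrt_hsSq (hsSq_mul_ne_top_left _ hRtop)
    have h5 : Tendsto (fun n => M n * R * ContinuousLinearMap.adjoint (M n * R)) atTop
        (𝓝 (R * R)) := by
      have := ((ContinuousLinearMap.adjoint (𝕜 := ℂ) (E := H) (F := H)).continuous.tendsto
        _).comp h3
      rw [hR] at this
      exact h3.mul this
    have h6 : ∀ n, M n * (R * R) * ContinuousLinearMap.adjoint (M n) =
        M n * R * ContinuousLinearMap.adjoint (M n * R) := fun n => by
      rw [adjoint_mul, hR]
      simp only [mul_assoc]
    simp only [h6]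
    exact tendsto_const_nhds.inner
      (((ContinuousLinearMap.apply ℂ H (refBasis H j)).continuous.tendsto _).comp h5)
  · have h := traceNorm_adjoint_mul_self R
    rw [hR] at h
    simp only [traceNorm_conj hR, h]
    have := tendsto_hsSq_mul_of_strong (M := M) (D := 1) (R := R) (fun ψ => by simpa using hM ψ)
      hRtop
    rwa [one_mul] at this

/-! ### Weak* closedness of the cone -/

lemma summable_inner_mul_inner_prod {C D : H →L[ℂ] H} (hC : hsSq C ≠ ⊤) (hD : hsSq D ≠ ⊤) :
    Summable (fun p : basisIndex H × basisIndex H =>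
      (inner ℂ (C (refBasis H p.1)) (refBasis H p.2) *
        inner ℂ (refBasis H p.2) (D (refBasis H p.1)) : ℂ)) := by
  have hs : ∀ E : H →L[ℂ] H, hsSq E ≠ ⊤ → Summable
      (fun p : basisIndex H × basisIndex H =>
        ‖(inner ℂ (refBasis H p.2) (E (refBasis H p.1)) : ℂ)‖ ^ 2) := fun E hE => by
    have h : ∑' p : basisIndex H × basisIndex H,
        ‖(inner ℂ (refBasis H p.2) (E (refBasis H p.1)) : ℂ)‖ₑ ^ 2 ≠ ⊤ := by
      rw [ENNReal.tsum_prod']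
      simpa only [tsum_enorm_inner_sq, hsSq] using hE
    simpa using ENNReal.summable_toReal h
  refine Summable.of_norm_bounded ((hs C hC).add (hs D hD)) fun p => ?_
  rw [norm_mul, norm_inner_symm]
  nlinarith [sq_nonneg (‖(inner ℂ (refBasis H p.2) (C (refBasis H p.1)) : ℂ)‖
    - ‖(inner ℂ (refBasis H p.2) (D (refBasis H p.1)) : ℂ)‖),
    sq_nonneg ‖(inner ℂ (refBasis H p.2) (C (refBasis H p.1)) : ℂ)‖,
    sq_nonneg ‖(inner ℂ (refBasis H p.2) (D (refBasis H p.1)) : ℂ)‖]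

/-- Cyclicity `Tr (C† D) = Tr (D C†)`: both sides sum the same absolutely summable double family of
matrix entries. -/
lemma tsum_inner_apply_comm {C D : H →L[ℂ] H} (hC : hsSq C ≠ ⊤) (hD : hsSq D ≠ ⊤) :
    ∑' i, (inner ℂ (C (refBasis H i)) (D (refBasis H i)) : ℂ) =
      ∑' j, inner ℂ (ContinuousLinearMap.adjoint D (refBasis H j))
        (ContinuousLinearMap.adjoint C (refBasis H j)) := by
  have h := (summable_inner_mul_inner_prod hC hD).tsum_comm
    (f := fun i j => (inner ℂ (C (refBasis H i)) (refBasis H j) *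
        inner ℂ (refBasis H j) (D (refBasis H i)) : ℂ))
  simp only [HilbertBasis.tsum_inner_mul_inner] at h
  rw [← h]
  refine tsum_congr fun j => ?_
  rw [← (refBasis H).tsum_inner_mul_inner]
  refine tsum_congr fun i => ?_
  rw [ContinuousLinearMap.adjoint_inner_left, ContinuousLinearMap.adjoint_inner_right, mul_comm]

/-- For compact `M` the left side is one of the functionals defining the weak* topology, so weak*
convergence controls the traces of the conjugates. -/
lemma trace_mul_adjoint_mul_self {X : H →L[ℂ] H} (hX : X.IsPositive) (hX' : traceNorm X ≠ ⊤)
    (M : H →L[ℂ] H) :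
    trace (X * (ContinuousLinearMap.adjoint M * M)) =
      ((traceNorm (M * X * ContinuousLinearMap.adjoint M)).toReal : ℂ) := by
  obtain ⟨R, hR, rfl⟩ := exists_sqrt hX
  have hRtop : hsSq R ≠ ⊤ := by
    have h := traceNorm_adjoint_mul_self R
    rw [hR] at h
    exact h ▸ hX'
  have hD : hsSq (R * (ContinuousLinearMap.adjoint M * M)) ≠ ⊤ :=
    ne_top_of_le_ne_top (ENNReal.mul_ne_top (by simp) hRtop) (hsSq_mul_le_right _ R)
  rw [traceNorm_conj hR, trace]
  have e : ∀ i, (inner ℂ (refBasis H i)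
      ((R * R * (ContinuousLinearMap.adjoint M * M)) (refBasis H i)) : ℂ) =
      inner ℂ (R (refBasis H i)) ((R * (ContinuousLinearMap.adjoint M * M)) (refBasis H i)) := by
    intro i
    rw [← ContinuousLinearMap.adjoint_inner_right, hR]
    rfl
  simp only [e]
  rw [tsum_inner_apply_comm hRtop hD, hsSq, ENNReal.tsum_toReal_eq (by simp), Complex.ofReal_tsum]
  refine tsum_congr fun j => ?_
  rw [adjoint_mul, adjoint_mul, ContinuousLinearMap.adjoint_adjoint, hR]
  simp only [mul_apply_eq_comp]
  rw [ContinuousLinearMap.adjoint_inner_left, inner_self_eq_norm_sq_to_K]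
  simp

lemma trace_mul_rankOne (X : H →L[ℂ] H) (x y : H) :
    trace (X * InnerProductSpace.rankOne ℂ y x) = inner ℂ x (X y) := by
  rw [trace, ← (refBasis H).tsum_inner_mul_inner]
  refine tsum_congr fun i => ?_
  rw [mul_apply_eq_comp, InnerProductSpace.rankOne_apply, map_smul, inner_smul_right]

open scoped ComplexOrder in
lemma isPositive_of_tendsto {α : Type*} {l : Filter α} [l.NeBot] {A : α → H →L[ℂ] H}
    {X : H →L[ℂ] H} (hA : ∀ a, (A a).IsPositive)
    (hw : ∀ x y, Tendsto (fun a => (inner ℂ x (A a y) : ℂ)) l (𝓝 (inner ℂ x (X y)))) :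
    X.IsPositive := by
  rw [ContinuousLinearMap.isPositive_iff_complex]
  intro x
  have h : 0 ≤ (inner ℂ x (X x) : ℂ) :=
    ge_of_tendsto' (hw x x) fun a => (hA a).inner_nonneg_right x
  have h2 : 0 ≤ (inner ℂ (X x) x : ℂ) := by
    rw [← inner_conj_symm]
    exact star_nonneg_iff.2 h
  obtain ⟨h3, h4⟩ := Complex.nonneg_iff.1 h2
  exact ⟨Complex.ext rfl h4, h3⟩

theorem isWeakStarClosed_cone {M : ℕ → H →L[ℂ] H} (hMc : ∀ n, IsCompactOperator (M n))
    (hM : ∀ ψ, Tendsto (fun n => M n ψ) atTop (𝓝 ψ))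
    {F : Set (H →L[ℂ] H)} (hF : F ⊆ densityOperators H)
    (hFne : F.Nonempty) (hFclosed : IsTraceNormClosed F)
    (hFM : ∀ n, ∀ X ∈ cone F, M n * X * ContinuousLinearMap.adjoint (M n) ∈ cone F) :
    IsWeakStarClosed (cone F) := by
  let := weakStarTopology H
  change IsClosed {T : TraceClass H | T.1 ∈ cone F}
  refine isClosed_of_closure_subset fun X hX => ?_
  -- The weak* topology need not be first countable, so the point is approached along a filter
  -- instead of a sequence.
  rw [mem_closure_iff_comap_neBot] at hX
  have hK : ∀ K : H →L[ℂ] H, IsCompactOperator K →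
      Tendsto (fun T : {T : TraceClass H | T.1 ∈ cone F} => trace (T.1.1 * K))
        (comap (↑) (𝓝 X)) (𝓝 (trace (X.1 * K))) := by
    intro K hK
    have hcont : Continuous fun T : TraceClass H => trace (T.1 * K) :=
      continuous_iInf_dom (i := (⟨K, hK⟩ : {K : H →L[ℂ] H // IsCompactOperator K}))
        continuous_induced_dom
    exact (hcont.tendsto X).comp tendsto_comap
  have hw : ∀ x y, Tendsto (fun T : {T : TraceClass H | T.1 ∈ cone F} =>
      (inner ℂ x (T.1.1 y) : ℂ)) (comap (↑) (𝓝 X)) (𝓝 (inner ℂ x (X.1 y))) := by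
    intro x y
    simpa only [trace_mul_rankOne] using hK _ (isCompactOperator_rankOne y x)
  have hpos : X.1.IsPositive := isPositive_of_tendsto (fun T => isPositive_of_mem_cone hF T.2) hw
  refine mem_cone_of_tendsto_conj hM hF hFne hFclosed hFM (fun T => T.2) hpos X.2.ne hw
    fun n => ?_
  have h := hK (ContinuousLinearMap.adjoint (M n) * M n)
    ((hMc n).clm_comp (ContinuousLinearMap.adjoint (M n)))
  have h' : Tendsto (fun T : {T : TraceClass H | T.1 ∈ cone F} =>
      (((traceNorm (M n * T.1.1 * ContinuousLinearMap.adjoint (M n))).toReal : ℝ) : ℂ))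
      (comap (↑) (𝓝 X))
      (𝓝 ((traceNorm (M n * X.1 * ContinuousLinearMap.adjoint (M n))).toReal : ℂ)) := by
    rw [← trace_mul_adjoint_mul_self hpos X.2.ne]
    refine h.congr fun T => ?_
    exact trace_mul_adjoint_mul_self (isPositive_of_mem_cone hF T.2) T.1.2.ne _
  have h2 := (Complex.continuous_re.tendsto _).comp h'
  simp only [Function.comp_def, Complex.ofReal_re] at h2
  exact (ENNReal.tendsto_toReal_iff
    (fun T => traceNorm_conj_ne_top (isPositive_of_mem_cone hF T.2) T.1.2.ne _)
    (traceNorm_conj_ne_top hpos X.2.ne _)).1 h2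

/-! ### Bounded weakly convergent sequences -/

/-- The image of the unit ball under `M` has a finite net. Strong convergence is uniform on the net
and extends to the whole image because `1 - coordProj F` is a contraction. -/
lemma tendsto_one_sub_coordProj_mul {M : H →L[ℂ] H} (hM : IsCompactOperator M) :
    Tendsto (fun F => ‖(1 - coordProj F) * M‖) atTop (𝓝 0) := by
  rw [Metric.tendsto_nhds]
  intro ε hε
  have htb : TotallyBounded (M '' Metric.closedBall 0 1) :=
    ((IsCompactOperator.isCompact_closure_image_closedBall (f := M.toLinearMap) hM
      1).totallyBounded).subset subset_closure
  obtain ⟨t, ht, hcov⟩ := Metric.totallyBounded_iff.1 htb (ε / 4) (by positivity)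
  have hev : ∀ᶠ F in atTop, ∀ y ∈ t, ‖(1 - coordProj F : H →L[ℂ] H) y‖ < ε / 4 := by
    rw [ht.eventually_all]
    intro y _
    have h1 := (tendsto_coordProj y).const_sub y
    rw [sub_self] at h1
    have h2 := h1.norm
    rw [norm_zero] at h2
    exact h2.eventually (gt_mem_nhds (by positivity))
  filter_upwards [hev] with F hF
  rw [Real.dist_eq, sub_zero, abs_of_nonneg (norm_nonneg _)]
  refine lt_of_le_of_lt (ContinuousLinearMap.opNorm_le_of_unit_norm (C := ε / 2) (by positivity)
    fun x hx => ?_) (by linarith)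
  have hmem : M x ∈ M '' Metric.closedBall 0 1 := ⟨x, by simp [hx], rfl⟩
  obtain ⟨y, hy, hxy⟩ := Set.mem_iUnion₂.1 (hcov hmem)
  rw [Metric.mem_ball, dist_eq_norm] at hxy
  calc ‖((1 - coordProj F) * M) x‖
      = ‖(1 - coordProj F : H →L[ℂ] H) (M x - y) + (1 - coordProj F : H →L[ℂ] H) y‖ := by
        rw [← map_add, sub_add_cancel]; rfl
    _ ≤ ‖M x - y‖ + ε / 4 := (norm_add_le _ _).trans
        (add_le_add (norm_one_sub_coordProj_apply_le F _) (hF y hy).le)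
    _ ≤ ε / 2 := by linarith

/-- Outside `F` the trace of `M B M†` is at most `‖(1 - coordProj F) M‖² Tr B`, small uniformly over
`Tr B ≤ 1`; inside `F` finitely many matrix entries converge. -/
theorem tendsto_traceNorm_conj {α : Type*} {l : Filter α} {A : α → H →L[ℂ] H} {X M : H →L[ℂ] H}
    (hM : IsCompactOperator M) (hA : ∀ a, (A a).IsPositive) (hA' : ∀ a, traceNorm (A a) ≤ 1)
    (hX : X.IsPositive)
    (hw : ∀ x y, Tendsto (fun a => (inner ℂ x (A a y) : ℂ)) l (𝓝 (inner ℂ x (X y)))) :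
    Tendsto (fun a => traceNorm (M * A a * ContinuousLinearMap.adjoint M)) l
      (𝓝 (traceNorm (M * X * ContinuousLinearMap.adjoint M))) := by
  have hup : ∀ B : H →L[ℂ] H, B.IsPositive → traceNorm B ≤ 1 → ∀ F : Finset (basisIndex H),
      traceNorm (M * B * ContinuousLinearMap.adjoint M) ≤
        ∑ i ∈ F, ENNReal.ofReal (inner ℂ (refBasis H i)
          ((M * B * ContinuousLinearMap.adjoint M) (refBasis H i)) : ℂ).re +
        ‖(1 - coordProj F) * M‖ₑ ^ 2 := by
    intro B hB hB' F
    obtain ⟨R, hR, rfl⟩ := exists_sqrt hB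
    have hR' := traceNorm_adjoint_mul_self R
    rw [hR] at hR'
    rw [conj_eq_adjoint_mul_self hR, traceNorm_adjoint_mul_self]
    simp only [ofReal_re_inner_adjoint_mul_self]
    rw [← sum_add_hsSq_mul_one_sub_coordProj _ F]
    refine add_le_add le_rfl ?_
    rw [mul_assoc]
    refine (hsSq_mul_le_right _ _).trans ?_
    rw [← hR', ← enorm_adjoint, adjoint_mul, ContinuousLinearMap.adjoint_adjoint, map_sub,
      adjoint_coordProj, ContinuousLinearMap.adjoint_one]
    exact (mul_le_mul_right hB' _).trans (mul_one _).le
  have hlow : ∀ B : H →L[ℂ] H, B.IsPositive → ∀ F : Finset (basisIndex H),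
      ∑ i ∈ F, ENNReal.ofReal (inner ℂ (refBasis H i) (B (refBasis H i)) : ℂ).re ≤ traceNorm B := by
    intro B hB F
    rw [traceNorm_of_isPositive hB]
    exact ENNReal.sum_le_tsum F
  have hsum : ∀ F : Finset (basisIndex H), Tendsto (fun a =>
      ∑ i ∈ F, ENNReal.ofReal (inner ℂ (refBasis H i)
          ((M * A a * ContinuousLinearMap.adjoint M) (refBasis H i)) : ℂ).re) l
      (𝓝 (∑ i ∈ F, ENNReal.ofReal (inner ℂ (refBasis H i)
          ((M * X * ContinuousLinearMap.adjoint M) (refBasis H i)) : ℂ).re)) := by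
    intro F
    refine tendsto_finsetSum _ fun i _ => ENNReal.tendsto_ofReal ?_
    simp only [inner_conj]
    exact (Complex.continuous_re.tendsto _).comp (hw _ _)
  have hzero : Tendsto (fun F => ‖(1 - coordProj F) * M‖ₑ ^ 2) atTop (𝓝 0) := by
    have h := ENNReal.tendsto_ofReal ((tendsto_one_sub_coordProj_mul hM).pow 2)
    rw [zero_pow two_ne_zero, ENNReal.ofReal_zero] at h
    simpa only [enorm_sq_eq_ofReal] using h
  refine tendsto_order.2 ⟨fun c hc => ?_, fun c hc => ?_⟩
  · have h1 : Tendsto (fun F : Finset (basisIndex H) =>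
        ∑ i ∈ F, ENNReal.ofReal (inner ℂ (refBasis H i)
          ((M * X * ContinuousLinearMap.adjoint M) (refBasis H i)) : ℂ).re) atTop
        (𝓝 (traceNorm (M * X * ContinuousLinearMap.adjoint M))) := by
      rw [traceNorm_of_isPositive (isPositive_conj hX M)]
      exact ENNReal.summable.hasSum
    obtain ⟨F, hF⟩ := ((tendsto_order.1 h1).1 c hc).exists
    filter_upwards [(tendsto_order.1 (hsum F)).1 c hF] with a ha
    exact ha.trans_le (hlow _ (isPositive_conj (hA a) M) F)
  · have h1 : Tendsto (fun F => traceNorm (M * X * ContinuousLinearMap.adjoint M) +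
        ‖(1 - coordProj F) * M‖ₑ ^ 2) atTop
        (𝓝 (traceNorm (M * X * ContinuousLinearMap.adjoint M))) := by
      have := (tendsto_const_nhds
        (x := traceNorm (M * X * ContinuousLinearMap.adjoint M))).add hzero
      rwa [add_zero] at this
    obtain ⟨F, hF⟩ := ((tendsto_order.1 h1).2 c hc).exists
    have h2 := (hsum F).add (tendsto_const_nhds (x := ‖(1 - coordProj F) * M‖ₑ ^ 2))
    have h3 := lt_of_le_of_lt (add_le_add (hlow _ (isPositive_conj hX M) F) le_rfl) hF
    filter_upwards [(tendsto_order.1 h2).2 c h3] with a ha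
    exact (hup _ (hA a) (hA' a) F).trans_lt ha

end

section

/-! ### An integral representation of the entropy term -/

open MeasureTheory Set in
lemma lintegral_Ioi_of_hasDerivAt {g g' : ℝ → ℝ} {m : ℝ}
    (hg : ∀ s, 0 ≤ s → HasDerivAt g (g' s) s) (hg' : ∀ s, 0 < s → 0 ≤ g' s)
    (hm : Tendsto g atTop (𝓝 m)) :
    ∫⁻ s in Ioi (0 : ℝ), ENNReal.ofReal (g' s) = ENNReal.ofReal (m - g 0) := by
  have h1 := integrableOn_Ioi_deriv_of_nonneg' (fun s hs => hg s hs) (fun s hs => hg' s hs) hm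
  have h2 := integral_Ioi_of_hasDerivAt_of_nonneg' (fun s hs => hg s hs)
    (fun s hs => hg' s hs) hm
  rw [← h2, ofReal_integral_eq_lintegral_ofReal h1]
  exact (ae_restrict_iff' measurableSet_Ioi).2 (Eventually.of_forall fun s hs => hg' s hs)

open MeasureTheory Set in
lemma lintegral_inv_eq_top : ∫⁻ s in Ioc (0 : ℝ) 1, ENNReal.ofReal s⁻¹ = ⊤ := by
  by_contra h
  have hint : IntegrableOn (fun s : ℝ => s⁻¹) (Ioc 0 1) := by
    refine ⟨measurable_inv.aestronglyMeasurable, ?_⟩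
    rw [hasFiniteIntegral_iff_ofReal]
    · exact lt_top_iff_ne_top.2 h
    · exact (ae_restrict_iff' measurableSet_Ioc).2
        (Eventually.of_forall fun s hs => inv_nonneg.2 hs.1.le)
  have h2 : IntervalIntegrable (fun s : ℝ => s⁻¹) volume 0 1 :=
    (intervalIntegrable_iff_integrableOn_Ioc_of_le zero_le_one).2 hint
  rw [intervalIntegrable_inv_iff] at h2
  simp at h2

/-- The resolvent kernel whose superposition is the entropy term. -/
def entropyKernel (s x y : ℝ) : ℝ := (y - x) ^ 2 / (y + s * x)

open MeasureTheory Set in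
theorem lintegral_entropyKernel {x y : ℝ} (hx : 0 ≤ x) (hy : 0 ≤ y) :
    ∫⁻ s in Ioi (0 : ℝ), ENNReal.ofReal (entropyKernel s x y) *
      ENNReal.ofReal (1 / (1 + s) ^ 2) = entropyTerm x y := by
  have hk : ∀ s ∈ Ioi (0 : ℝ), ENNReal.ofReal (entropyKernel s x y) *
      ENNReal.ofReal (1 / (1 + s) ^ 2) =
        ENNReal.ofReal (entropyKernel s x y * (1 / (1 + s) ^ 2)) := by
    intro s hs
    have : (0 : ℝ) < s := hs
    rw [ENNReal.ofReal_mul]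
    unfold entropyKernel
    positivity
  rw [setLIntegral_congr_fun measurableSet_Ioi hk]
  have hlim : Tendsto (fun s : ℝ => (y - x) / (1 + s)) atTop (𝓝 0) :=
    tendsto_const_nhds.div_atTop (tendsto_atTop_add_const_left _ _ tendsto_id)
  have hd : ∀ s : ℝ, 0 ≤ s → HasDerivAt (fun s : ℝ => (y - x) / (1 + s))
      (-(y - x) / (1 + s) ^ 2) s := by
    intro s hs
    have h1 : HasDerivAt (fun s : ℝ => 1 + s) 1 s := (hasDerivAt_id s).const_add 1
    have h2 := (hasDerivAt_const s (y - x)).div h1 (by positivity)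
    refine h2.congr_deriv ?_
    simp
  rcases hx.eq_or_lt with rfl | hx
  · have h1 := lintegral_Ioi_of_hasDerivAt (g := fun s => -((y - 0) / (1 + s)))
      (g' := fun s => entropyKernel s 0 y * (1 / (1 + s) ^ 2)) (m := 0)
      (fun s hs => by
        refine (hd s hs).neg.congr_deriv ?_
        unfold entropyKernel
        by_cases hy0 : y = 0
        · simp [hy0]
        · field_simp
          ring)
      (fun s hs => by unfold entropyKernel; positivity) (by simpa using hlim.neg)
    rw [h1, entropyTerm, if_neg (by simp)]
    simp
  rcases hy.eq_or_lt with rfl | hy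
  -- For `y = 0 < x` the kernel is `x / s`, and the weight is at least `1 / 4` on `(0, 1]`, so the
  -- integral diverges like that of `1 / s`.
  · rw [entropyTerm, if_pos ⟨rfl, hx.ne'⟩, eq_top_iff]
    have h0 : ENNReal.ofReal (x / 4) * ∫⁻ s in Ioc (0 : ℝ) 1, ENNReal.ofReal s⁻¹ = ⊤ := by
      rw [lintegral_inv_eq_top, ENNReal.mul_top]
      simpa using hx
    rw [← h0, ← lintegral_const_mul _ (by fun_prop)]
    refine le_trans ?_ (lintegral_mono_set (s := Ioc 0 1) Ioc_subset_Ioi_self)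
    refine setLIntegral_mono' measurableSet_Ioc fun s hs => ?_
    rw [← ENNReal.ofReal_mul (by positivity)]
    refine ENNReal.ofReal_le_ofReal ?_
    have hs0 := hs.1
    unfold entropyKernel
    have e : (0 - x) ^ 2 / (0 + s * x) * (1 / (1 + s) ^ 2) = x * s⁻¹ * (1 / (1 + s) ^ 2) := by
      field_simp
      ring
    rw [e]
    have h4 : 1 / 4 ≤ 1 / (1 + s) ^ 2 := by
      refine one_div_le_one_div_of_le (by positivity) ?_
      nlinarith [hs.2]
    have h5 : 0 ≤ x * s⁻¹ := by positivity
    nlinarith [mul_le_mul_of_nonneg_left h4 h5]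
  -- An explicit primitive, normalised by `log (x * (1 + s))` so that it vanishes at infinity; its
  -- value at `0` is minus the entropy term.
  · have h1 := lintegral_Ioi_of_hasDerivAt
      (g := fun s => x * (Real.log (y + s * x) - Real.log (x * (1 + s))) - (y - x) / (1 + s))
      (g' := fun s => entropyKernel s x y * (1 / (1 + s) ^ 2)) (m := 0)
      (fun s hs => by
        have hp : 0 < y + s * x := by positivity
        have hq : 0 < x * (1 + s) := by positivity
        have d1 : HasDerivAt (fun s : ℝ => y + s * x) x s := by
          simpa using ((hasDerivAt_id s).mul_const x).const_add y
        have d2 : HasDerivAt (fun s : ℝ => x * (1 + s)) x s := by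
          simpa using ((hasDerivAt_id s).const_add 1).const_mul x
        refine ((((d1.log hp.ne').sub (d2.log hq.ne')).const_mul x).sub (hd s hs)).congr_deriv ?_
        unfold entropyKernel
        have : 0 < 1 + s := by positivity
        field_simp
        ring)
      (fun s hs => by unfold entropyKernel; positivity)
      (by
        have h2 : Tendsto (fun s : ℝ => (y - x) / (1 + s) / x + 1) atTop (𝓝 1) := by
          simpa using (hlim.div_const x).add_const 1
        have h3 := ((Real.continuousAt_log one_ne_zero).tendsto.comp h2).const_mul x
        rw [Real.log_one, mul_zero] at h3
        have h4 := h3.sub hlim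
        rw [sub_zero] at h4
        refine h4.congr' ?_
        filter_upwards [eventually_ge_atTop 0] with s hs
        have hp : 0 < y + s * x := by positivity
        have hq : 0 < x * (1 + s) := by positivity
        have : 0 < 1 + s := by positivity
        rw [← Real.log_div hp.ne' hq.ne', Function.comp_apply]
        congr 3
        field_simp
        ring)
    rw [h1, entropyTerm, if_neg (by simp [hy.ne'])]
    congr 1
    simp
    ring

/-! ### A variational formula -/

lemma ofReal_le_tsum_of_hasSum {ι : Type*} {r : ι → ℝ} {R : ℝ} (h : HasSum r R) :
    ENNReal.ofReal R ≤ ∑' p, ENNReal.ofReal (r p) := by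
  refine le_of_tendsto (ENNReal.tendsto_ofReal h) (Eventually.of_forall fun s => ?_)
  refine le_trans ?_ (ENNReal.sum_le_tsum s)
  exact Finset.le_sum_of_subadditive _ ENNReal.ofReal_zero.le (fun _ _ => ENNReal.ofReal_add_le) s r

/-- Completing the square: for `D > 0` the maximum over `z` is reached at `z = (d / D) u`. The
condition `hd` covers the degenerate case. -/
lemma re_variational_le {d D : ℝ} (hD : 0 ≤ D) (hd : D = 0 → d = 0) (u z : ℂ) :
    (2 * (d : ℂ) * ((starRingEnd ℂ) u * z) - (D : ℂ) * (z * (starRingEnd ℂ) z)).re ≤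
      ‖u‖ ^ 2 * (d ^ 2 / D) := by
  have h1 : (2 * (d : ℂ) * ((starRingEnd ℂ) u * z) - (D : ℂ) * (z * (starRingEnd ℂ) z)).re
      = 2 * d * ((starRingEnd ℂ) u * z).re - D * ‖z‖ ^ 2 := by
    rw [Complex.mul_conj, Complex.normSq_eq_norm_sq, ← Complex.ofReal_mul, Complex.sub_re,
      Complex.ofReal_re, mul_assoc, Complex.mul_re, Complex.re_ofReal_mul]
    simp
    ring
  rw [h1]
  rcases hD.eq_or_lt with h0 | hpos
  · rw [hd h0.symm, ← h0]
    simp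
  have h2 : d * ((starRingEnd ℂ) u * z).re ≤ |d| * (‖u‖ * ‖z‖) := by
    refine (le_abs_self _).trans ?_
    rw [abs_mul]
    gcongr
    refine (Complex.abs_re_le_norm _).trans ?_
    rw [norm_mul, RCLike.norm_conj]
  have h3 : ‖u‖ ^ 2 * (d ^ 2 / D) = (‖u‖ * |d|) ^ 2 / D := by
    rw [mul_pow, sq_abs]; ring
  rw [h3, le_div_iff₀ hpos]
  nlinarith [sq_nonneg (‖u‖ * |d| - D * ‖z‖)]

variable {H : Type u} [NormedAddCommGroup H] [InnerProductSpace ℂ H] [CompleteSpace H]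

/-- The functional `2 Re Tr (Z (Y - X)) - Tr (Z Y Z†) - s Tr (Z† X Z)` for the finite rank operator
`Z = ∑ k, |a k⟩⟨b k|`. -/
def quadFunctional {κ : Type*} (s : ℝ) (X Y : H →L[ℂ] H) (S : Finset κ) (a b : κ → H) : ℝ :=
  (∑ k ∈ S, 2 * (inner ℂ (b k) (Y (a k)) - inner ℂ (b k) (X (a k))) -
    ∑ k ∈ S, ∑ m ∈ S, (inner ℂ (a m) (a k) * inner ℂ (b k) (Y (b m)) +
      (s : ℂ) * (inner ℂ (a m) (X (a k)) * inner ℂ (b k) (b m))) : ℂ).re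

lemma tendsto_quadFunctional {κ α : Type*} {l : Filter α} (s : ℝ) {A B : α → H →L[ℂ] H}
    {X Y : H →L[ℂ] H}
    (hA : ∀ x y, Tendsto (fun n => (inner ℂ x (A n y) : ℂ)) l (𝓝 (inner ℂ x (X y))))
    (hB : ∀ x y, Tendsto (fun n => (inner ℂ x (B n y) : ℂ)) l (𝓝 (inner ℂ x (Y y))))
    (S : Finset κ) (a b : κ → H) :
    Tendsto (fun n => quadFunctional s (A n) (B n) S a b) l (𝓝 (quadFunctional s X Y S a b)) := by
  refine (Complex.continuous_re.tendsto _).comp (Tendsto.sub ?_ ?_)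
  · exact tendsto_finsetSum _ fun k _ => ((hB _ _).sub (hA _ _)).const_mul 2
  · exact tendsto_finsetSum _ fun k _ => tendsto_finsetSum _ fun m _ =>
      ((hB _ _).const_mul _).add (((hA _ _).mul_const _).const_mul _)

namespace SpectralDecomposition

variable {X Y : H →L[ℂ] H}

lemma val_eq (e : SpectralDecomposition X) (i : e.ι) :
    e.val i = (inner ℂ (e.vec i) (X (e.vec i)) : ℂ).re := by
  rw [e.inner_apply, Complex.ofReal_re]

lemma val_nonneg (hX : X.IsPositive) (e : SpectralDecomposition X) (i : e.ι) : 0 ≤ e.val i := by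
  rw [e.val_eq]
  exact re_inner_nonneg hX _

lemma tsum_ofReal_val (hX : X.IsPositive) (e : SpectralDecomposition X) :
    ∑' i, ENNReal.ofReal (e.val i) = traceNorm X := by
  rw [traceNorm_eq_tsum e.vec hX]
  simp only [e.val_eq]

lemma summable_val (hX : X.IsPositive) (hX' : traceNorm X ≠ ⊤) (e : SpectralDecomposition X) :
    Summable e.val := by
  rw [← e.tsum_ofReal_val hX] at hX'
  refine (ENNReal.summable_toReal hX').congr fun i => ?_
  rw [ENNReal.toReal_ofReal (e.val_nonneg hX i)]

lemma inner_vec_apply (hX : X.IsPositive) (e : SpectralDecomposition X) (i : e.ι) (x : H) :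
    (inner ℂ (e.vec i) (X x) : ℂ) = e.val i * inner ℂ (e.vec i) x := by
  rw [← hX.inner_left_eq_inner_right, e.apply_vec, inner_smul_left, Complex.conj_ofReal]

lemma hasSum_inner_apply (hX : X.IsPositive) (e : SpectralDecomposition X) (x y : H) :
    HasSum (fun i => (e.val i : ℂ) * (inner ℂ x (e.vec i) * inner ℂ (e.vec i) y))
      (inner ℂ x (X y)) := by
  have h : (fun i => (e.val i : ℂ) * (inner ℂ x (e.vec i) * inner ℂ (e.vec i) y)) =
      fun i => inner ℂ x (e.vec i) * inner ℂ (e.vec i) (X y) := by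
    funext i
    rw [e.inner_vec_apply hX]
    ring
  rw [h]
  exact e.vec.hasSum_inner_mul_inner x (X y)

end SpectralDecomposition

variable {X Y : H →L[ℂ] H}

lemma summable_val_mul_norm_sq (hY : Y.IsPositive) (hY' : traceNorm Y ≠ ⊤)
    {ι : Type*} (e : HilbertBasis ι ℂ H) (f : SpectralDecomposition Y) :
    Summable fun p : ι × f.ι => f.val p.2 * ‖(inner ℂ (e p.1) (f.vec p.2) : ℂ)‖ ^ 2 := by
  have h : ∑' p : ι × f.ι, ENNReal.ofReal (f.val p.2) *
      ‖(inner ℂ (e p.1) (f.vec p.2) : ℂ)‖ₑ ^ 2 ≠ ⊤ := by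
    rw [ENNReal.tsum_prod', ENNReal.tsum_comm]
    simp only [ENNReal.tsum_mul_left, tsum_enorm_inner_sq]
    have : ∀ j, ‖f.vec j‖ₑ = 1 := fun j => by
      rw [← ofReal_norm, f.vec.orthonormal.1 j, ENNReal.ofReal_one]
    simpa only [this, one_pow, mul_one, f.tsum_ofReal_val hY] using hY'
  refine (ENNReal.summable_toReal h).congr fun p => ?_
  rw [ENNReal.toReal_mul, ENNReal.toReal_ofReal (f.val_nonneg hY _)]
  simp

/-- The entry is expanded in two bases at once so that each summand contains the overlap of `e i`
and `f j`. Finite trace makes the double family absolutely summable. -/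
lemma hasSum_linear_term (hY : Y.IsPositive) (hY' : traceNorm Y ≠ ⊤) {ι : Type*}
    (e : HilbertBasis ι ℂ H) (f : SpectralDecomposition Y) (a b : H) :
    HasSum (fun p : ι × f.ι => (f.val p.2 : ℂ) * (inner ℂ (f.vec p.2) (e p.1) *
      (inner ℂ (e p.1) a * inner ℂ b (f.vec p.2)))) (inner ℂ b (Y a)) := by
  have hs : Summable (fun p : ι × f.ι => (f.val p.2 : ℂ) * (inner ℂ (f.vec p.2) (e p.1) *
      (inner ℂ (e p.1) a * inner ℂ b (f.vec p.2)))) := by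
    have h1 := summable_val_mul_norm_sq hY hY' e f
    have h2 : Summable fun p : ι × f.ι => ‖(inner ℂ (e p.1) a : ℂ)‖ ^ 2 * f.val p.2 :=
      (hasSum_norm_inner_sq e a).summable.mul_of_nonneg (f.summable_val hY hY')
        (fun _ => by positivity) (f.val_nonneg hY)
    refine Summable.of_norm_bounded ((h1.add h2).mul_left ‖b‖) fun p => ?_
    have hb : ‖(inner ℂ b (f.vec p.2) : ℂ)‖ ≤ ‖b‖ := by
      simpa [f.vec.orthonormal.1 p.2] using norm_inner_le_norm (𝕜 := ℂ) b (f.vec p.2)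
    have hv := f.val_nonneg hY p.2
    rw [norm_mul, norm_mul, norm_mul, Complex.norm_real, Real.norm_eq_abs, abs_of_nonneg hv,
      norm_inner_symm (f.vec p.2)]
    set U := ‖(inner ℂ (e p.1) (f.vec p.2) : ℂ)‖
    set V := ‖(inner ℂ (e p.1) a : ℂ)‖
    have hUV : U * V ≤ U ^ 2 + V ^ 2 := by nlinarith [sq_nonneg (U - V), sq_nonneg U, sq_nonneg V]
    calc f.val p.2 * (U * (V * ‖(inner ℂ b (f.vec p.2) : ℂ)‖))
        = f.val p.2 * ((U * V) * ‖(inner ℂ b (f.vec p.2) : ℂ)‖) := by ring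
      _ ≤ f.val p.2 * ((U ^ 2 + V ^ 2) * ‖b‖) := by gcongr
      _ = _ := by ring
  rw [← (Equiv.prodComm f.ι ι).hasSum_iff]
  have hs' := (Equiv.prodComm f.ι ι).summable_iff.2 hs
  have h3 : inner ℂ b (Y a) = ∑' p : f.ι × ι, ((fun p : ι × f.ι => (f.val p.2 : ℂ) *
      (inner ℂ (f.vec p.2) (e p.1) *
      (inner ℂ (e p.1) a * inner ℂ b (f.vec p.2)))) ∘ Equiv.prodComm f.ι ι) p := by
    rw [hs'.tsum_prod, ← (f.hasSum_inner_apply hY b a).tsum_eq]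
    refine tsum_congr fun j => ?_
    simp only [Function.comp_apply, Equiv.prodComm_apply, Prod.fst_swap, Prod.snd_swap]
    rw [tsum_mul_left, ← e.tsum_inner_mul_inner (f.vec j) a, ← tsum_mul_left]
    congr 1
    exact tsum_congr fun i => by ring
  rw [h3]
  exact hs'.hasSum

lemma hasSum_linear_term' (hX : X.IsPositive) (hX' : traceNorm X ≠ ⊤) {κ : Type*}
    (e : SpectralDecomposition X) (f : HilbertBasis κ ℂ H) (a b : H) :
    HasSum (fun p : e.ι × κ => (e.val p.1 : ℂ) * (inner ℂ (f p.2) (e.vec p.1) *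
      (inner ℂ (e.vec p.1) a * inner ℂ b (f p.2)))) (inner ℂ b (X a)) := by
  have h := hasSum_linear_term hX hX' f e b a
  rw [← (Equiv.prodComm e.ι κ).hasSum_iff] at h
  have h2 := Complex.hasSum_conj'.2 h
  rw [inner_conj_symm, hX.inner_left_eq_inner_right] at h2
  convert h2 using 2 with p
  simp only [Function.comp_apply, Equiv.prodComm_apply, Prod.fst_swap, Prod.snd_swap, map_mul,
    inner_conj_symm, Complex.conj_ofReal]
  ring

lemma hasSum_mul_prod {ι κ : Type*} {f : ι → ℂ} {g : κ → ℂ} {c d : ℂ} (hf : HasSum f c)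
    (hg : HasSum g d) : HasSum (fun p : ι × κ => f p.1 * g p.2) (c * d) :=
  hf.mul hg (summable_mul_of_summable_norm hf.summable.norm hg.summable.norm)

lemma hasSum_quadratic_term (hY : Y.IsPositive) {ι : Type*}
    (e : HilbertBasis ι ℂ H) (f : SpectralDecomposition Y) (a a' b b' : H) :
    HasSum (fun p : ι × f.ι => (inner ℂ a' (e p.1) * inner ℂ (e p.1) a) *
      ((f.val p.2 : ℂ) * (inner ℂ b (f.vec p.2) * inner ℂ (f.vec p.2) b')))
      ((inner ℂ a' a : ℂ) * inner ℂ b (Y b')) := by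
  have h1 := e.hasSum_inner_mul_inner a' a
  have h2 := f.hasSum_inner_apply hY b b'
  have h3 := hasSum_mul_prod h1 h2
  exact h3

lemma hasSum_quadratic_term' (hX : X.IsPositive) {κ : Type*}
    (e : SpectralDecomposition X) (f : HilbertBasis κ ℂ H) (a a' b b' : H) :
    HasSum (fun p : e.ι × κ => ((e.val p.1 : ℂ) * (inner ℂ a' (e.vec p.1) *
      inner ℂ (e.vec p.1) a)) * (inner ℂ b (f p.2) * inner ℂ (f p.2) b'))
      ((inner ℂ a' (X a) : ℂ) * inner ℂ b b') := by
  have h1 := e.hasSum_inner_apply hX a' a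
  have h2 := f.hasSum_inner_mul_inner b b'
  have h3 := hasSum_mul_prod h1 h2
  exact h3

/-- The overlap sum of the resolvent kernels. -/
def kernelSum (s : ℝ) (e : SpectralDecomposition X) (f : SpectralDecomposition Y) : ℝ≥0∞ :=
  ∑' p : e.ι × f.ι, ENNReal.ofReal (‖(inner ℂ (e.vec p.1) (f.vec p.2) : ℂ)‖ ^ 2) *
    ENNReal.ofReal (entropyKernel s (e.val p.1) (f.val p.2))

/-- Expanded over both eigenbases, the functional has summands `2 (y - x) Re (ū z) - (y + s x)
|z|²`, where `u` is the overlap and `z = ⟨e i, Z f j⟩`; `re_variational_le` bounds each one. -/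
theorem ofReal_quadFunctional_le (hX : X.IsPositive) (hX' : traceNorm X ≠ ⊤)
    (hY : Y.IsPositive) (hY' : traceNorm Y ≠ ⊤) (e : SpectralDecomposition X)
    (f : SpectralDecomposition Y) {s : ℝ} (hs : 0 < s) {κ : Type*} (S : Finset κ) (a b : κ → H) :
    ENNReal.ofReal (quadFunctional s X Y S a b) ≤ kernelSum s e f := by
  have hsum : HasSum (fun p : e.ι × f.ι =>
      ∑ k ∈ S, 2 * ((f.val p.2 : ℂ) * (inner ℂ (f.vec p.2) (e.vec p.1) *
          (inner ℂ (e.vec p.1) (a k) * inner ℂ (b k) (f.vec p.2))) -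
        (e.val p.1 : ℂ) * (inner ℂ (f.vec p.2) (e.vec p.1) *
          (inner ℂ (e.vec p.1) (a k) * inner ℂ (b k) (f.vec p.2)))) -
      ∑ k ∈ S, ∑ m ∈ S, ((inner ℂ (a m) (e.vec p.1) * inner ℂ (e.vec p.1) (a k)) *
          ((f.val p.2 : ℂ) * (inner ℂ (b k) (f.vec p.2) * inner ℂ (f.vec p.2) (b m))) +
        (s : ℂ) * (((e.val p.1 : ℂ) * (inner ℂ (a m) (e.vec p.1) *
          inner ℂ (e.vec p.1) (a k))) *
          (inner ℂ (b k) (f.vec p.2) * inner ℂ (f.vec p.2) (b m)))))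
      (∑ k ∈ S, 2 * (inner ℂ (b k) (Y (a k)) - inner ℂ (b k) (X (a k))) -
        ∑ k ∈ S, ∑ m ∈ S, (inner ℂ (a m) (a k) * inner ℂ (b k) (Y (b m)) +
          (s : ℂ) * (inner ℂ (a m) (X (a k)) * inner ℂ (b k) (b m))) : ℂ) := by
    refine HasSum.sub ?_ ?_
    · exact hasSum_sum fun k _ => ((hasSum_linear_term hY hY' e.vec f (a k) (b k)).sub
        (hasSum_linear_term' hX hX' e f.vec (a k) (b k))).mul_left 2
    · exact hasSum_sum fun k _ => hasSum_sum fun m _ =>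
        (hasSum_quadratic_term hY e.vec f (a k) (a m) (b k) (b m)).add
        ((hasSum_quadratic_term' hX e f.vec (a k) (a m) (b k) (b m)).mul_left (s : ℂ))
  refine (ofReal_le_tsum_of_hasSum (Complex.hasSum_re hsum)).trans
    (ENNReal.tsum_le_tsum fun p => ?_)
  rw [← ENNReal.ofReal_mul (by positivity)]
  refine ENNReal.ofReal_le_ofReal ?_
  set x := e.val p.1 with hx
  set y := f.val p.2 with hy
  have hx0 : 0 ≤ x := e.val_nonneg hX _
  have hy0 : 0 ≤ y := f.val_nonneg hY _
  set z : ℂ := ∑ k ∈ S, inner ℂ (e.vec p.1) (a k) * inner ℂ (b k) (f.vec p.2) with hz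
  have hzc : (starRingEnd ℂ) z = ∑ m ∈ S, inner ℂ (a m) (e.vec p.1) * inner ℂ (f.vec p.2) (b m) := by
    rw [hz, map_sum]
    simp only [map_mul, inner_conj_symm]
  have key := re_variational_le (d := y - x) (D := y + s * x) (by positivity) (fun h => by
    have h1 : y = 0 := by nlinarith [mul_nonneg hs.le hx0]
    have h2 : s * x = 0 := by linarith
    have h3 : x = 0 := (mul_eq_zero.1 h2).resolve_left hs.ne'
    rw [h1, h3, sub_zero]) (inner ℂ (e.vec p.1) (f.vec p.2)) z
  refine le_trans (le_of_eq ?_) key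
  congr 1
  congr 1
  · rw [inner_conj_symm, hz, Finset.mul_sum, Finset.mul_sum]
    refine Finset.sum_congr rfl fun k _ => ?_
    push_cast
    ring
  · rw [hzc, hz, Finset.sum_mul_sum, Finset.mul_sum]
    refine Finset.sum_congr rfl fun k _ => ?_
    rw [Finset.mul_sum]
    refine Finset.sum_congr rfl fun m _ => ?_
    push_cast
    ring

/-- The termwise maximiser restricted to `S` is the finite rank operator `Z = ∑ w ⟨e i, f j⟩ |e i⟩⟨f
j|` with `w = (y - x) / (y + s x)`; orthonormality removes the cross terms. -/
theorem exists_sum_eq_ofReal_quadFunctional (hX : X.IsPositive)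
    (hY : Y.IsPositive) (e : SpectralDecomposition X)
    (f : SpectralDecomposition Y) {s : ℝ} (hs : 0 < s) (S : Finset (e.ι × f.ι)) :
    ∃ a b : e.ι × f.ι → H,
    ∑ p ∈ S, ENNReal.ofReal (‖(inner ℂ (e.vec p.1) (f.vec p.2) : ℂ)‖ ^ 2) *
      ENNReal.ofReal (entropyKernel s (e.val p.1) (f.val p.2)) =
    ENNReal.ofReal (quadFunctional s X Y S a b) := by
  classical
  let w : e.ι × f.ι → ℝ := fun p => (f.val p.2 - e.val p.1) / (f.val p.2 + s * e.val p.1)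
  let z : e.ι × f.ι → ℂ := fun p => (w p : ℂ) * inner ℂ (e.vec p.1) (f.vec p.2)
  refine ⟨fun p => z p • e.vec p.1, fun p => f.vec p.2, ?_⟩
  have hx0 := e.val_nonneg hX
  have hy0 := f.val_nonneg hY
  have hk : ∀ p : e.ι × f.ι, 0 ≤ entropyKernel s (e.val p.1) (f.val p.2) := fun p => by
    have := hx0 p.1
    have := hy0 p.2
    unfold entropyKernel
    positivity
  simp only [← ENNReal.ofReal_mul (sq_nonneg ‖(inner ℂ (e.vec _) (f.vec _) : ℂ)‖)]
  rw [← ENNReal.ofReal_sum_of_nonneg fun p _ => mul_nonneg (by positivity) (hk p)]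
  congr 1
  have ee : ∀ i j, (inner ℂ (e.vec i) (e.vec j) : ℂ) = if i = j then 1 else 0 :=
    orthonormal_iff_ite.1 e.vec.orthonormal
  have ff : ∀ i j, (inner ℂ (f.vec i) (f.vec j) : ℂ) = if i = j then 1 else 0 :=
    orthonormal_iff_ite.1 f.vec.orthonormal
  have hquad : ∀ p ∈ S, ∑ q ∈ S, ((inner ℂ (z q • e.vec q.1) (z p • e.vec p.1) : ℂ) *
      inner ℂ (f.vec p.2) (Y (f.vec q.2)) +
      (s : ℂ) * (inner ℂ (z q • e.vec q.1) (X (z p • e.vec p.1)) *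
        inner ℂ (f.vec p.2) (f.vec q.2))) =
      (((w p) ^ 2 * ‖(inner ℂ (e.vec p.1) (f.vec p.2) : ℂ)‖ ^ 2 *
        (f.val p.2 + s * e.val p.1) : ℝ) : ℂ) := by
    intro p hp
    have hzz : (starRingEnd ℂ) (z p) * z p =
        (((w p) ^ 2 * ‖(inner ℂ (e.vec p.1) (f.vec p.2) : ℂ)‖ ^ 2 : ℝ) : ℂ) := by
      rw [mul_comm, Complex.mul_conj, Complex.normSq_eq_norm_sq, norm_mul, Complex.norm_real,
        Real.norm_eq_abs, mul_pow, sq_abs]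
    rw [Finset.sum_eq_single_of_mem p hp]
    · rw [f.apply_vec, map_smul, e.apply_vec]
      simp only [inner_smul_left, inner_smul_right, ee, ff, if_true, mul_one]
      rw [Complex.ofReal_mul, ← hzz]
      push_cast
      ring
    · intro q _ hqp
      rw [f.apply_vec, map_smul, e.apply_vec]
      simp only [inner_smul_left, inner_smul_right, ee, ff]
      by_cases h1 : q.1 = p.1
      · have h2 : p.2 ≠ q.2 := fun h => hqp (Prod.ext h1 h.symm)
        simp [h2]
      · simp [h1]
  have hlin : ∀ p, (2 * (inner ℂ (f.vec p.2) (Y (z p • e.vec p.1)) -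
      inner ℂ (f.vec p.2) (X (z p • e.vec p.1))) : ℂ) =
      ((2 * w p * ‖(inner ℂ (e.vec p.1) (f.vec p.2) : ℂ)‖ ^ 2 *
        (f.val p.2 - e.val p.1) : ℝ) : ℂ) := by
    intro p
    have hzu : z p * inner ℂ (f.vec p.2) (e.vec p.1) =
        ((w p * ‖(inner ℂ (e.vec p.1) (f.vec p.2) : ℂ)‖ ^ 2 : ℝ) : ℂ) := by
      rw [← inner_conj_symm (f.vec p.2), mul_assoc, Complex.mul_conj, Complex.normSq_eq_norm_sq]
      push_cast
      ring
    rw [f.inner_vec_apply hY, map_smul, e.apply_vec]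
    simp only [inner_smul_right]
    have := congrArg (fun t : ℂ => 2 * ((f.val p.2 : ℂ) - e.val p.1) * t) hzu
    refine Eq.trans ?_ (this.trans ?_)
    · ring
    · push_cast
      ring
  unfold quadFunctional
  rw [Finset.sum_congr rfl hquad, Finset.sum_congr rfl fun p _ => hlin p, ← Complex.ofReal_sum,
    ← Complex.ofReal_sum, ← Complex.ofReal_sub, Complex.ofReal_re, ← Finset.sum_sub_distrib]
  refine Finset.sum_congr rfl fun p _ => ?_
  have hx := hx0 p.1
  have hy := hy0 p.2
  simp only [w, entropyKernel]
  by_cases hD : f.val p.2 + s * e.val p.1 = 0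
  · simp [hD]
  · field_simp
    ring

/-! ### Lower semicontinuity of the entropy sums -/

/-- Countability is what permits exchanging the overlap sum with the integral over `s`. -/
lemma countable_of_hilbertBasis [TopologicalSpace.SeparableSpace H] {ι : Type*}
    (g : HilbertBasis ι ℂ H) : Countable ι := by
  have hdist : ∀ i j, i ≠ j → 1 ≤ dist (g i) (g j) := by
    intro i j hij
    have h1 := norm_sub_sq (𝕜 := ℂ) (g i) (g j)
    rw [g.orthonormal.1 i, g.orthonormal.1 j, g.orthonormal.2 hij] at h1
    rw [dist_eq_norm]
    simp at h1
    nlinarith [norm_nonneg (g i - g j)]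
  have hdisj : Pairwise (Function.onFun Disjoint fun i => Metric.ball (g i) (1 / 2)) := by
    intro i j hij
    exact Metric.ball_disjoint_ball (by linarith [hdist i j hij])
  exact hdisj.countable_of_isOpen_disjoint (fun i => Metric.isOpen_ball)
    fun i => ⟨g i, by simp⟩

/-- The overlap sum of the entropy terms. -/
def entropySum (e : SpectralDecomposition X) (f : SpectralDecomposition Y) : ℝ≥0∞ :=
  ∑' (i : e.ι) (j : f.ι),
    ENNReal.ofReal (‖inner ℂ (e.vec i) (f.vec j)‖ ^ 2) * entropyTerm (e.val i) (f.val j)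

lemma measurable_entropyKernel (x y : ℝ) : Measurable fun s => entropyKernel s x y := by
  unfold entropyKernel
  fun_prop

lemma measurable_kernelSum [TopologicalSpace.SeparableSpace H] (e : SpectralDecomposition X)
    (f : SpectralDecomposition Y) : Measurable fun s => kernelSum s e f := by
  have := countable_of_hilbertBasis e.vec
  have := countable_of_hilbertBasis f.vec
  exact Measurable.tsum fun p =>
    (measurable_entropyKernel _ _).ennreal_ofReal.const_mul _

open MeasureTheory in
lemma entropySum_eq_lintegral [TopologicalSpace.SeparableSpace H] (hX : X.IsPositive)
    (hY : Y.IsPositive) (e : SpectralDecomposition X) (f : SpectralDecomposition Y) :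
    entropySum e f = ∫⁻ s in Set.Ioi (0 : ℝ), kernelSum s e f *
      ENNReal.ofReal (1 / (1 + s) ^ 2) := by
  have := countable_of_hilbertBasis e.vec
  have := countable_of_hilbertBasis f.vec
  simp only [kernelSum, ← ENNReal.tsum_mul_right]
  rw [lintegral_tsum, entropySum, ← ENNReal.tsum_prod]
  · refine tsum_congr fun p => ?_
    rw [← lintegral_entropyKernel (e.val_nonneg hX _) (f.val_nonneg hY _), ← lintegral_const_mul]
    · simp only [mul_assoc]
    · exact (measurable_entropyKernel _ _).ennreal_ofReal.mul (by fun_prop)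
  · intro p
    exact (((measurable_entropyKernel _ _).ennreal_ofReal.const_mul _).mul
      (by fun_prop)).aemeasurable

open MeasureTheory in
-- For fixed `s`, a finite partial sum for the limit equals the functional at some fixed `a`, `b`.
-- The functional converges along `n` and stays below the kernel sums; Fatou's lemma integrates this
-- over `s`.
theorem entropySum_le_liminf [TopologicalSpace.SeparableSpace H] {A B : ℕ → H →L[ℂ] H}
    (hA : ∀ n, (A n).IsPositive) (hA' : ∀ n, traceNorm (A n) ≠ ⊤)
    (hB : ∀ n, (B n).IsPositive) (hB' : ∀ n, traceNorm (B n) ≠ ⊤)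
    (hX : X.IsPositive) (hY : Y.IsPositive)
    (hAw : ∀ x y, Tendsto (fun n => (inner ℂ x (A n y) : ℂ)) atTop (𝓝 (inner ℂ x (X y))))
    (hBw : ∀ x y, Tendsto (fun n => (inner ℂ x (B n y) : ℂ)) atTop (𝓝 (inner ℂ x (Y y))))
    (e : SpectralDecomposition X) (f : SpectralDecomposition Y)
    (eA : ∀ n, SpectralDecomposition (A n)) (fB : ∀ n, SpectralDecomposition (B n)) :
    entropySum e f ≤ liminf (fun n => entropySum (eA n) (fB n)) atTop := by
  simp only [fun n => entropySum_eq_lintegral (hA n) (hB n) (eA n) (fB n)]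
  rw [entropySum_eq_lintegral hX hY]
  refine le_trans ?_ (lintegral_liminf_le fun n =>
    (measurable_kernelSum (eA n) (fB n)).mul (by fun_prop))
  refine setLIntegral_mono' measurableSet_Ioi fun s hs => ?_
  rw [kernelSum, ← ENNReal.tsum_mul_right]
  refine ENNReal.summable.tsum_le_of_sum_le fun S => ?_
  rw [← Finset.sum_mul]
  obtain ⟨a, b, hab⟩ := exists_sum_eq_ofReal_quadFunctional hX hY e f hs S
  rw [hab]
  have hlim := ENNReal.Tendsto.mul_const (b := ENNReal.ofReal (1 / (1 + s) ^ 2))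
    (ENNReal.tendsto_ofReal (tendsto_quadFunctional s hAw hBw S a b))
    (Or.inr ENNReal.ofReal_ne_top)
  rw [← hlim.liminf_eq]
  refine liminf_le_liminf (Eventually.of_forall fun n => ?_)
  exact mul_le_mul_left (ofReal_quadFunctional_le (hA n) (hA' n) (hB n) (hB' n) _ _ hs S a b) _

/-- Semicontinuity along constant sequences compares any two choices of decompositions, so the sum
does not depend on the choice. -/
theorem relEntropy_eq_entropySum [TopologicalSpace.SeparableSpace H]
    (hX : X.IsPositive) (hX' : traceNorm X ≠ ⊤) (hY : Y.IsPositive) (hY' : traceNorm Y ≠ ⊤)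
    (e : SpectralDecomposition X) (f : SpectralDecomposition Y) :
    relEntropy X Y = entropySum e f := by
  refine le_antisymm (iInf_le_of_le e (iInf_le_of_le f le_rfl))
    (le_iInf fun e' => le_iInf fun f' => ?_)
  have := entropySum_le_liminf (A := fun _ => X) (B := fun _ => Y) (fun _ => hX) (fun _ => hX')
    (fun _ => hY) (fun _ => hY') hX hY (fun _ _ => tendsto_const_nhds)
    (fun _ _ => tendsto_const_nhds) e f (fun _ => e') (fun _ => f')
  rwa [liminf_const] at this

lemma exists_spectralDecomposition_of_isPositive (hX : X.IsPositive) (hX' : traceNorm X ≠ ⊤) :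
    Nonempty (SpectralDecomposition X) := by
  obtain ⟨R, hR, hRX⟩ := exists_sqrt hX
  refine exists_spectralDecomposition ?_ hX.isSelfAdjoint
  have h := traceNorm_adjoint_mul_self R
  rw [hR, hRX] at h
  rw [← hRX]
  exact isCompactOperator_mul_self (h ▸ hX')

/-- Joint lower semicontinuity of the relative entropy under weak convergence. -/
theorem relEntropy_le_liminf [TopologicalSpace.SeparableSpace H] {A B : ℕ → H →L[ℂ] H}
    (hA : ∀ n, (A n).IsPositive) (hA' : ∀ n, traceNorm (A n) ≠ ⊤)
    (hB : ∀ n, (B n).IsPositive) (hB' : ∀ n, traceNorm (B n) ≠ ⊤)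
    (hX : X.IsPositive) (hX' : traceNorm X ≠ ⊤) (hY : Y.IsPositive) (hY' : traceNorm Y ≠ ⊤)
    (hAw : ∀ x y, Tendsto (fun n => (inner ℂ x (A n y) : ℂ)) atTop (𝓝 (inner ℂ x (X y))))
    (hBw : ∀ x y, Tendsto (fun n => (inner ℂ x (B n y) : ℂ)) atTop (𝓝 (inner ℂ x (Y y)))) :
    relEntropy X Y ≤ liminf (fun n => relEntropy (A n) (B n)) atTop := by
  obtain ⟨e⟩ := exists_spectralDecomposition_of_isPositive hX hX'
  obtain ⟨f⟩ := exists_spectralDecomposition_of_isPositive hY hY'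
  have eA := fun n => (exists_spectralDecomposition_of_isPositive (hA n) (hA' n)).some
  have fB := fun n => (exists_spectralDecomposition_of_isPositive (hB n) (hB' n)).some
  rw [relEntropy_eq_entropySum hX hX' hY hY' e f]
  simp only [fun n => relEntropy_eq_entropySum (hA n) (hA' n) (hB n) (hB' n) (eA n) (fB n)]
  exact entropySum_le_liminf hA hA' hB hB' hX hY hAw hBw e f eA fB

end

section

variable {H : Type u} [NormedAddCommGroup H] [InnerProductSpace ℂ H] [CompleteSpace H]

/-! ### Weak sequential compactness -/

lemma enorm_apply_le_traceNorm (T : H →L[ℂ] H) (x : H) : ‖T x‖ₑ ≤ traceNorm T * ‖x‖ₑ := by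
  have hpos : (CFC.abs T).IsPositive :=
    (ContinuousLinearMap.nonneg_iff_isPositive _).1 (CFC.abs_nonneg T)
  have hsa : ContinuousLinearMap.adjoint (CFC.abs T) = CFC.abs T := hpos.isSelfAdjoint
  have hn : ‖T x‖ = ‖CFC.abs T x‖ := by
    have h1 := inner_adjoint_mul_self T x
    have h2 := inner_adjoint_mul_self (CFC.abs T) x
    rw [hsa, CFC.abs_mul_abs, ContinuousLinearMap.star_eq_adjoint, h1] at h2
    have h3 : ‖T x‖ ^ 2 = ‖CFC.abs T x‖ ^ 2 := Complex.ofReal_injective h2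
    exact (sq_eq_sq₀ (norm_nonneg _) (norm_nonneg _)).1 h3
  obtain ⟨S, hS, hST⟩ := exists_sqrt hpos
  have htr : traceNorm T = hsSq S := by
    rw [← traceNorm_adjoint_mul_self, hS, hST, traceNorm, traceNorm_of_isPositive hpos]
  rw [← ofReal_norm, hn, ofReal_norm, ← hST, htr]
  refine (ENNReal.pow_le_pow_left_iff (n := 2) (by norm_num)).1 ?_
  calc ‖(S * S) x‖ₑ ^ 2 ≤ hsSq S * ‖S x‖ₑ ^ 2 := enorm_sq_le_hsSq S (S x)
    _ ≤ hsSq S * (hsSq S * ‖x‖ₑ ^ 2) := by gcongr; exact enorm_sq_le_hsSq S x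
    _ = _ := by ring

lemma norm_le_one_of_traceNorm_le_one {T : H →L[ℂ] H} (hT : traceNorm T ≤ 1) : ‖T‖ ≤ 1 := by
  refine T.opNorm_le_bound zero_le_one fun x => ?_
  have h := (enorm_apply_le_traceNorm T x).trans (mul_le_mul_left hT ‖x‖ₑ)
  rw [one_mul, ← ofReal_norm, ← ofReal_norm, ENNReal.ofReal_le_ofReal_iff (norm_nonneg _)] at h
  rwa [one_mul]

lemma tendsto_inner_of_traceNorm {α : Type*} {l : Filter α} {A : α → H →L[ℂ] H} {X : H →L[ℂ] H}
    (h : Tendsto (fun a => traceNorm (A a - X)) l (𝓝 0)) (x y : H) :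
    Tendsto (fun a => (inner ℂ x (A a y) : ℂ)) l (𝓝 (inner ℂ x (X y))) := by
  refine tendsto_const_nhds.inner ?_
  rw [tendsto_iff_edist_tendsto_0]
  have h2 := ENNReal.Tendsto.mul_const (b := ‖y‖ₑ) h (Or.inr (by simp))
  rw [zero_mul] at h2
  refine tendsto_of_tendsto_of_tendsto_of_le_of_le tendsto_const_nhds h2
    (fun _ => zero_le) fun a => ?_
  rw [edist_eq_enorm_sub]
  exact enorm_apply_le_traceNorm (A a - X) y

/-- An `ε / 3` argument from the common Lipschitz constant; it carries convergence of matrix entries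
from a dense set to all vectors. -/
lemma isClosed_setOf_cauchySeq {E : Type*} [PseudoMetricSpace E] {f : ℕ → E → ℂ} {L : ℝ}
    (hf : ∀ n x y, dist (f n x) (f n y) ≤ L * dist x y) :
    IsClosed {x | CauchySeq fun n => f n x} := by
  refine isClosed_of_closure_subset fun x hx => ?_
  rw [Set.mem_ofPred_eq, Metric.cauchySeq_iff]
  intro ε hε
  have hL : 0 < |L| + 1 := by positivity
  obtain ⟨y, hy, hxy⟩ := Metric.mem_closure_iff.1 hx (ε / (3 * (|L| + 1))) (by positivity)
  obtain ⟨N, hN⟩ := Metric.cauchySeq_iff.1 hy (ε / 3) (by positivity)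
  have hb : ∀ n, dist (f n x) (f n y) < ε / 3 := fun n => by
    calc dist (f n x) (f n y) ≤ L * dist x y := hf n x y
      _ ≤ (|L| + 1) * dist x y := by
        gcongr
        linarith [le_abs_self L]
      _ < (|L| + 1) * (ε / (3 * (|L| + 1))) := by gcongr
      _ = ε / 3 := by field_simp
  refine ⟨N, fun m hm n hn => ?_⟩
  have h1 := hb m
  have h2 := hb n
  have h3 := hN m hm n hn
  have h4 := dist_triangle4 (f m x) (f m y) (f n y) (f n x)
  rw [dist_comm (f n y)] at h4
  linarith

/-- The limits of `⟨T n x, y⟩` form a bounded sesquilinear form, which the Riesz representation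
turns into an operator. -/
lemma exists_weak_limit {T : ℕ → H →L[ℂ] H} (hT : ∀ n, ‖T n‖ ≤ 1)
    (hc : ∀ x y, CauchySeq fun n => (inner ℂ x (T n y) : ℂ)) :
    ∃ X : H →L[ℂ] H, ∀ x y, Tendsto (fun n => (inner ℂ x (T n y) : ℂ)) atTop
      (𝓝 (inner ℂ x (X y))) := by
  have hc' : ∀ x y, ∃ c, Tendsto (fun n => (inner ℂ (T n x) y : ℂ)) atTop (𝓝 c) := by
    intro x y
    obtain ⟨c, hc⟩ := cauchySeq_tendsto_of_complete (hc y x)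
    refine ⟨(starRingEnd ℂ) c, ((Complex.continuous_conj.tendsto _).comp hc).congr fun n => ?_⟩
    rw [Function.comp_apply, inner_conj_symm]
  choose B hB using hc'
  let B₁ : H →ₗ⋆[ℂ] H →ₗ[ℂ] ℂ := LinearMap.mk₂'ₛₗ (starRingEnd ℂ) (RingHom.id ℂ) B
    (fun x x' y => tendsto_nhds_unique (hB _ _) (((hB x y).add (hB x' y)).congr fun n => by
      rw [map_add, inner_add_left]))
    (fun c x y => tendsto_nhds_unique (hB _ _) (((hB x y).const_mul _).congr fun n => by
      rw [map_smul, inner_smul_left]))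
    (fun x y y' => tendsto_nhds_unique (hB _ _) (((hB x y).add (hB x y')).congr fun n => by
      rw [inner_add_right]))
    (fun c x y => tendsto_nhds_unique (hB _ _) (((hB x y).const_mul _).congr fun n => by
      rw [inner_smul_right, RingHom.id_apply]))
  let B₂ : H →L⋆[ℂ] H →L[ℂ] ℂ := B₁.mkContinuous₂ 1 fun x y => by
    refine le_of_tendsto (hB x y).norm (Eventually.of_forall fun n => ?_)
    refine (norm_inner_le_norm _ _).trans ?_
    gcongr
    exact (T n).le_of_opNorm_le (hT n) x
  refine ⟨InnerProductSpace.continuousLinearMapOfBilin B₂, fun x y => ?_⟩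
  have h := (Complex.continuous_conj.tendsto _).comp (hB y x)
  have e : (inner ℂ x (InnerProductSpace.continuousLinearMapOfBilin B₂ y) : ℂ) =
      (starRingEnd ℂ) (B y x) := by
    rw [← inner_conj_symm, InnerProductSpace.continuousLinearMapOfBilin_apply]
    rfl
  rw [e]
  refine h.congr fun n => ?_
  rw [Function.comp_apply, inner_conj_symm]

theorem exists_subseq_weak_limit [TopologicalSpace.SeparableSpace H] {T : ℕ → H →L[ℂ] H}
    (hT : ∀ n, ‖T n‖ ≤ 1) :
    ∃ φ : ℕ → ℕ, StrictMono φ ∧ ∃ X : H →L[ℂ] H, ∀ x y,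
      Tendsto (fun n => (inner ℂ x (T (φ n) y) : ℂ)) atTop (𝓝 (inner ℂ x (X y))) := by
  let d := TopologicalSpace.denseSeq H
  have hd : Dense (Set.range d) := TopologicalSpace.denseRange_denseSeq H
  -- Tychonoff over the countably many entries indexed by a dense sequence replaces the diagonal
  -- argument.
  have hK : IsCompact (Set.univ.pi fun p : ℕ × ℕ =>
      Metric.closedBall (0 : ℂ) (‖d p.1‖ * ‖d p.2‖)) :=
    isCompact_univ_pi fun p => isCompact_closedBall _ _
  have hbound : ∀ n x y, ‖(inner ℂ x (T n y) : ℂ)‖ ≤ ‖x‖ * ‖y‖ := fun n x y => by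
    refine (norm_inner_le_norm _ _).trans ?_
    gcongr
    simpa using (T n).le_of_opNorm_le (hT n) y
  obtain ⟨c, -, φ, hφ, hlim⟩ := hK.tendsto_subseq
    (x := fun n p => (inner ℂ (d p.1) (T n (d p.2)) : ℂ)) fun n p _ => by
      rw [Metric.mem_closedBall, dist_zero_right]
      exact hbound n _ _
  refine ⟨φ, hφ, exists_weak_limit (fun n => hT (φ n)) fun x y => ?_⟩
  have h1 : ∀ i j, CauchySeq fun n => (inner ℂ (d i) (T (φ n) (d j)) : ℂ) := fun i j =>
    ((tendsto_pi_nhds.1 hlim) (i, j)).cauchySeq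
  have h2 : ∀ i y, CauchySeq fun n => (inner ℂ (d i) (T (φ n) y) : ℂ) := fun i y => by
    have hcl := isClosed_setOf_cauchySeq (f := fun n y => (inner ℂ (d i) (T (φ n) y) : ℂ))
      (L := ‖d i‖) fun n y y' => by
        rw [dist_eq_norm, dist_eq_norm, ← inner_sub_right, ← map_sub]
        exact hbound _ _ _
    exact closure_minimal (Set.range_subset_iff.2 fun j => h1 i j) hcl (hd y)
  have hcl := isClosed_setOf_cauchySeq (f := fun n x => (inner ℂ x (T (φ n) y) : ℂ))
    (L := ‖y‖) fun n x x' => by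
      rw [dist_eq_norm, dist_eq_norm, ← inner_sub_left, mul_comm]
      exact hbound _ _ _
  exact closure_minimal (Set.range_subset_iff.2 fun i => h2 i y) hcl (hd x)

lemma traceNorm_le_of_tendsto {α : Type*} {l : Filter α} [l.NeBot] {A : α → H →L[ℂ] H}
    {X : H →L[ℂ] H} {c : ℝ≥0∞} (hA : ∀ a, (A a).IsPositive) (hA' : ∀ a, traceNorm (A a) ≤ c)
    (hX : X.IsPositive)
    (hw : ∀ x y, Tendsto (fun a => (inner ℂ x (A a y) : ℂ)) l (𝓝 (inner ℂ x (X y)))) :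
    traceNorm X ≤ c := by
  rw [traceNorm_of_isPositive hX]
  refine ENNReal.summable.tsum_le_of_sum_le fun F => ?_
  refine le_of_tendsto' (tendsto_finsetSum F fun i _ => ENNReal.tendsto_ofReal
    ((Complex.continuous_re.tendsto _).comp (hw (refBasis H i) (refBasis H i)))) fun a => ?_
  refine le_trans ?_ (hA' a)
  rw [traceNorm_of_isPositive (hA a)]
  exact ENNReal.sum_le_tsum F

/-! ### Rescaling the second argument of the relative entropy -/

lemma entropy_summand_nonneg {x y : ℝ} (hx : 0 ≤ x) (hy : 0 < y) :
    0 ≤ x * Real.log x - x * Real.log y + y - x := by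
  rcases hx.eq_or_lt with rfl | hx
  · simpa using hy.le
  have h := Real.log_le_sub_one_of_pos (div_pos hy hx)
  rw [Real.log_div hy.ne' hx.ne'] at h
  have h2 := mul_le_mul_of_nonneg_left h hx.le
  have h3 : x * (y / x - 1) = y - x := by field_simp
  rw [h3] at h2
  linarith

/-- All correction terms are nonnegative and placed additively, so the identity survives infinite
values without subtraction in `ℝ≥0∞`. -/
lemma entropyTerm_mul {x y t : ℝ} (hx : 0 ≤ x) (hy : 0 ≤ y) (ht : 0 < t) (ht1 : t ≤ 1) :
    entropyTerm x (t * y) + ENNReal.ofReal (1 - t) * ENNReal.ofReal y =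
      entropyTerm x y + ENNReal.ofReal (-Real.log t) * ENNReal.ofReal x := by
  have hlog : 0 ≤ -Real.log t := by linarith [Real.log_nonpos ht.le ht1]
  rcases hy.eq_or_lt with rfl | hy
  · by_cases hx0 : x = 0
    · simp [hx0]
    · simp [entropyTerm, hx0]
  · have hty : 0 < t * y := by positivity
    rw [entropyTerm, entropyTerm, if_neg (by simp [hty.ne']), if_neg (by simp [hy.ne']),
      ← ENNReal.ofReal_mul (by linarith), ← ENNReal.ofReal_mul hlog,
      ← ENNReal.ofReal_add (entropy_summand_nonneg hx hty)
        (mul_nonneg (by linarith) hy.le),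
      ← ENNReal.ofReal_add (entropy_summand_nonneg hx hy) (mul_nonneg hlog hx),
      Real.log_mul ht.ne' hy.ne']
    congr 1
    ring

/-- The spectral decomposition of a real multiple. -/
def SpectralDecomposition.smul {T : H →L[ℂ] H} (f : SpectralDecomposition T) (t : ℝ) :
    SpectralDecomposition (t • T) where
  ι := f.ι
  vec := f.vec
  val := fun i => t * f.val i
  apply_vec := fun i => by
    rw [smul_apply, f.apply_vec, ← Complex.coe_smul, smul_smul, Complex.ofReal_mul]

variable {X Y : H →L[ℂ] H}

lemma tsum_overlap_left {κ : Type*} (e : SpectralDecomposition X) (g : HilbertBasis κ ℂ H)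
    (c : ℝ≥0∞) (r : e.ι → ℝ≥0∞) :
    ∑' (i : e.ι) (j : κ), ENNReal.ofReal (‖(inner ℂ (e.vec i) (g j) : ℂ)‖ ^ 2) * (c * r i) =
      c * ∑' i, r i := by
  have h1 : ∀ i, ∑' j, ENNReal.ofReal (‖(inner ℂ (e.vec i) (g j) : ℂ)‖ ^ 2) = 1 := fun i => by
    simp only [← enorm_sq_eq_ofReal, enorm_inner_symm (e.vec i)]
    rw [tsum_enorm_inner_sq, enorm_sq_eq_ofReal, e.vec.orthonormal.1 i]
    simp
  simp only [ENNReal.tsum_mul_right, h1, one_mul, ENNReal.tsum_mul_left]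

lemma tsum_overlap_right {κ : Type*} (f : SpectralDecomposition Y) (g : HilbertBasis κ ℂ H)
    (c : ℝ≥0∞) (r : f.ι → ℝ≥0∞) :
    ∑' (i : κ) (j : f.ι), ENNReal.ofReal (‖(inner ℂ (g i) (f.vec j) : ℂ)‖ ^ 2) * (c * r j) =
      c * ∑' j, r j := by
  rw [ENNReal.tsum_comm, ← tsum_overlap_left f g c r]
  simp only [norm_inner_symm (g _)]

lemma entropySum_smul_eq (e : SpectralDecomposition X) (f : SpectralDecomposition Y) (t : ℝ) :
    entropySum e (f.smul t) = ∑' (i : e.ι) (j : f.ι),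
      ENNReal.ofReal (‖(inner ℂ (e.vec i) (f.vec j) : ℂ)‖ ^ 2) *
        entropyTerm (e.val i) (t * f.val j) :=
  rfl

lemma entropySum_smul (hX : X.IsPositive) (hY : Y.IsPositive) (e : SpectralDecomposition X)
    (f : SpectralDecomposition Y) {t : ℝ} (ht : 0 < t) (ht1 : t ≤ 1) :
    entropySum e (f.smul t) + ENNReal.ofReal (1 - t) * traceNorm Y =
      entropySum e f + ENNReal.ofReal (-Real.log t) * traceNorm X := by
  rw [← f.tsum_ofReal_val hY, ← e.tsum_ofReal_val hX, ← tsum_overlap_right f e.vec,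
    ← tsum_overlap_left e f.vec, entropySum_smul_eq, entropySum, ← ENNReal.tsum_add,
    ← ENNReal.tsum_add]
  refine tsum_congr fun i => ?_
  rw [← ENNReal.tsum_add, ← ENNReal.tsum_add]
  refine tsum_congr fun j => ?_
  rw [← mul_add, ← mul_add]
  congr 1
  exact entropyTerm_mul (e.val_nonneg hX i) (f.val_nonneg hY j) ht ht1

/-- An eigenvector with nonzero eigenvalue overlaps some vector of the other basis, and that single
term is infinite. -/
lemma entropySum_zero (hX : X.IsPositive) (hX0 : traceNorm X ≠ 0) (e : SpectralDecomposition X)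
    (f : SpectralDecomposition Y) : entropySum e (f.smul 0) = ⊤ := by
  rw [← e.tsum_ofReal_val hX] at hX0
  obtain ⟨i, hi⟩ : ∃ i, ENNReal.ofReal (e.val i) ≠ 0 := by
    by_contra! h
    exact hX0 (ENNReal.tsum_eq_zero.2 h)
  have hxi : e.val i ≠ 0 := fun h => hi (by rw [h, ENNReal.ofReal_zero])
  obtain ⟨j, hj⟩ : ∃ j, (inner ℂ (f.vec j) (e.vec i) : ℂ) ≠ 0 := by
    by_contra! h
    have h1 := hasSum_norm_inner_sq f.vec (e.vec i)
    have h2 := h1.tsum_eq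
    simp [h, e.vec.orthonormal.1 i] at h2
  rw [entropySum_smul_eq]
  refine ENNReal.tsum_eq_top_of_eq_top ⟨i, ENNReal.tsum_eq_top_of_eq_top ⟨j, ?_⟩⟩
  have hterm : entropyTerm (e.val i) (0 * f.val j) = ⊤ := if_pos ⟨zero_mul _, hxi⟩
  rw [hterm]
  refine ENNReal.mul_top ?_
  have : 0 < ‖(inner ℂ (e.vec i) (f.vec j) : ℂ)‖ := by
    rw [norm_inner_symm]
    exact norm_pos_iff.2 hj
  have h2 : 0 < ENNReal.ofReal (‖(inner ℂ (e.vec i) (f.vec j) : ℂ)‖ ^ 2) :=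
    ENNReal.ofReal_pos.2 (by positivity)
  exact h2.ne'

lemma relEntropy_le_relEntropy_smul [TopologicalSpace.SeparableSpace H] {ρ σ : H →L[ℂ] H}
    (hρ : ρ ∈ densityOperators H) (hσ : σ ∈ densityOperators H) {t : ℝ} (ht : 0 ≤ t)
    (ht1 : t ≤ 1) : relEntropy ρ σ ≤ relEntropy ρ (t • σ) := by
  obtain ⟨e⟩ := exists_spectralDecomposition_of_isPositive hρ.1 hρ.2.1.ne
  obtain ⟨f⟩ := exists_spectralDecomposition_of_isPositive hσ.1 hσ.2.1.ne
  have htr : traceNorm (t • σ) ≠ ⊤ := by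
    rw [traceNorm_smul hσ.1 ht, traceNorm_of_mem_density hσ, mul_one]
    exact ENNReal.ofReal_ne_top
  rw [relEntropy_eq_entropySum hρ.1 hρ.2.1.ne hσ.1 hσ.2.1.ne e f,
    relEntropy_eq_entropySum hρ.1 hρ.2.1.ne (isPositive_real_smul hσ.1 ht) htr e (f.smul t)]
  rcases ht.eq_or_lt with rfl | ht
  · rw [entropySum_zero hρ.1 (by rw [traceNorm_of_mem_density hρ]; exact one_ne_zero)]
    exact le_top
  · have h := entropySum_smul hρ.1 hσ.1 e f ht ht1
    rw [traceNorm_of_mem_density hρ, traceNorm_of_mem_density hσ, mul_one, mul_one] at h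
    -- The gain `1 - t` from the trace term never exceeds the logarithmic penalty for shrinking `σ`.
    have hlog : 1 - t ≤ -Real.log t := by linarith [Real.log_le_sub_one_of_pos ht]
    have h2 : entropySum e f + ENNReal.ofReal (1 - t) ≤
        entropySum e (f.smul t) + ENNReal.ofReal (1 - t) := by
      rw [h]
      gcongr
    exact (ENNReal.add_le_add_iff_right ENNReal.ofReal_ne_top).1 h2

/-! ### Attainment and lower semicontinuity -/

/-- The common core of attainment (constant `ρs`) and of lower semicontinuity (varying `ρs`). -/
theorem exists_mem_relEntropy_le [TopologicalSpace.SeparableSpace H] {M : ℕ → H →L[ℂ] H}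
    (hMc : ∀ n, IsCompactOperator (M n))
    (hM : ∀ ψ, Tendsto (fun n => M n ψ) atTop (𝓝 ψ))
    {F : Set (H →L[ℂ] H)} (hF : F ⊆ densityOperators H)
    (hFne : F.Nonempty) (hFclosed : IsTraceNormClosed F)
    (hFM : ∀ n, ∀ X ∈ cone F, M n * X * ContinuousLinearMap.adjoint (M n) ∈ cone F)
    {ρ : H →L[ℂ] H} {ρs σs : ℕ → H →L[ℂ] H} {c : ℕ → ℝ≥0∞} {d : ℝ≥0∞}
    (hρ : ρ ∈ densityOperators H) (hρs : ∀ n, ρs n ∈ densityOperators H) (hσs : ∀ n, σs n ∈ F)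
    (hw : ∀ x y, Tendsto (fun n => (inner ℂ x (ρs n y) : ℂ)) atTop (𝓝 (inner ℂ x (ρ y))))
    (hle : ∀ n, relEntropy (ρs n) (σs n) ≤ c n) (hc : Tendsto c atTop (𝓝 d)) :
    ∃ σ ∈ F, relEntropy ρ σ ≤ d := by
  have htr : ∀ n, traceNorm (σs n) = 1 := fun n => traceNorm_of_mem_density (hF (hσs n))
  obtain ⟨φ, hφ, X, hX⟩ := exists_subseq_weak_limit (T := σs)
    fun n => norm_le_one_of_traceNorm_le_one (htr n).le
  have hXpos : X.IsPositive := isPositive_of_tendsto (fun n => (hF (hσs (φ n))).1) hX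
  have hXtr : traceNorm X ≤ 1 :=
    traceNorm_le_of_tendsto (fun n => (hF (hσs (φ n))).1) (fun n => (htr (φ n)).le) hXpos hX
  have hXtop : traceNorm X ≠ ⊤ := ne_top_of_le_ne_top ENNReal.one_ne_top hXtr
  have hcone : X ∈ cone F := by
    refine mem_cone_of_tendsto_conj hM hF hFne hFclosed hFM
      (fun n => ⟨1, zero_le_one, σs (φ n), hσs _, (one_smul ℝ _).symm⟩) hXpos hXtop hX fun n => ?_
    exact tendsto_traceNorm_conj (hMc n) (fun n => (hF (hσs (φ n))).1)
      (fun n => (htr (φ n)).le) hXpos hX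
  have hent : relEntropy ρ X ≤ d := by
    refine (relEntropy_le_liminf (A := fun n => ρs (φ n)) (B := fun n => σs (φ n))
      (fun n => (hρs _).1) (fun n => (hρs _).2.1.ne) (fun n => (hF (hσs _)).1)
      (fun n => (hF (hσs _)).2.1.ne) hρ.1 hρ.2.1.ne hXpos hXtop
      (fun x y => (hw x y).comp hφ.tendsto_atTop) hX).trans ?_
    rw [← (hc.comp hφ.tendsto_atTop).liminf_eq]
    exact liminf_le_liminf (Eventually.of_forall fun n => hle (φ n))
  -- The weak limit may have lost trace, so it is only a multiple `t • σ` with `t ≤ 1`; rescaling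
  -- brings it back into `F`.
  obtain ⟨t, ht, σ, hσ, rfl⟩ := hcone
  rw [traceNorm_smul (hF hσ).1 ht, traceNorm_of_mem_density (hF hσ), mul_one,
    ENNReal.ofReal_le_one] at hXtr
  exact ⟨σ, hσ, (relEntropy_le_relEntropy_smul hρ (hF hσ) ht hXtr).trans hent⟩

end

end QResource

theorem theorem2 {H : Type*} [NormedAddCommGroup H] [InnerProductSpace ℂ H] [CompleteSpace H]
    [TopologicalSpace.SeparableSpace H]
    (M : ℕ → H →L[ℂ] H) (hMcompact : ∀ n, IsCompactOperator (M n))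
    (hMlim : ∀ ψ : H, Tendsto (fun n => M n ψ) atTop (𝓝 ψ))
    (F : Set (H →L[ℂ] H)) (hF : F ⊆ QResource.densityOperators H) (hFne : F.Nonempty)
    (hFconvex : Convex ℝ F) (hFclosed : QResource.IsTraceNormClosed F)
    (hFM : ∀ n, ∀ X ∈ QResource.cone F,
      M n * X * ContinuousLinearMap.adjoint (M n) ∈ QResource.cone F) :
    QResource.IsWeakStarClosed (QResource.cone F) ∧
    (∀ ρ ∈ QResource.densityOperators H, ∃ σ ∈ F,
      QResource.relEntropyOfResource F ρ = QResource.relEntropy ρ σ) ∧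
    (∀ (ρ : H →L[ℂ] H) (ρs : ℕ → H →L[ℂ] H), ρ ∈ QResource.densityOperators H →
      (∀ n, ρs n ∈ QResource.densityOperators H) →
      Tendsto (fun n => QResource.traceNorm (ρs n - ρ)) atTop (𝓝 0) →
      QResource.relEntropyOfResource F ρ ≤
        liminf (fun n => QResource.relEntropyOfResource F (ρs n)) atTop) := by
  refine ⟨QResource.isWeakStarClosed_cone hMcompact hMlim hF hFne hFclosed hFM,
    fun ρ hρ => ?_, fun ρ ρs hρ hρs hlim => ?_⟩
  · obtain ⟨u, -, hu, hmem⟩ := exists_seq_tendsto_sInf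
      (S := QResource.relEntropy ρ '' F) (hFne.image _) (OrderBot.bddBelow _)
    choose σs hσs hσu using hmem
    rw [sInf_image] at hu
    obtain ⟨σ, hσ, hle⟩ := QResource.exists_mem_relEntropy_le hMcompact hMlim hF hFne hFclosed hFM
      (ρs := fun _ => ρ) hρ (fun _ => hρ) hσs (fun _ _ => tendsto_const_nhds)
      (fun n => (hσu n).le) hu
    exact ⟨σ, hσ, le_antisymm (iInf₂_le σ hσ) hle⟩
  · refine le_of_forall_gt_imp_ge_of_dense fun c hc => ?_
    obtain ⟨φ, hφ, hlt⟩ := extraction_of_frequently_atTop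
      (frequently_lt_of_liminf_lt (by isBoundedDefault) hc)
    have hex : ∀ n, ∃ σ ∈ F, QResource.relEntropy (ρs (φ n)) σ < c := fun n => by
      simpa only [QResource.relEntropyOfResource, iInf_lt_iff, exists_prop] using hlt n
    choose σs hσs hσc using hex
    obtain ⟨σ, hσ, hle⟩ := QResource.exists_mem_relEntropy_le hMcompact hMlim hF hFne hFclosed hFM
      (ρs := fun n => ρs (φ n)) hρ (fun n => hρs _) hσs
      (fun x y => (QResource.tendsto_inner_of_traceNorm hlim x y).comp hφ.tendsto_atTop)
      (fun n => (hσc n).le) tendsto_const_nhds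
    exact (iInf₂_le σ hσ).trans hle

end
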